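/- **Setting.** Let $r_0>0$ and let $(E_r)_{0<r\le r_0}$ be real Banach spaces. Each $E_r$ carries a closed convex cone $\mathcal C_r$ with $\mathbb R_+\mathcal C_r=\mathcal C_r$ and $\mathcal C_r\cap(-\mathcal C_r)=\{0\}$, a functional $\ell_r\in E_r'$ with $\|\ell_r\|=1$, and constants $\rho_r\in(0,1]$, $K_r\ge 1$, $\vartheta_r\ge1$, such that $\langle \ell_r,\phi\rangle\ge \|\phi\|/K_r$ for $\phi\in\mathcal C_r$ and such that $\mathcal C_r(\rho_r)=\{\phi\in\mathcal C_r: B(\phi,\rho_r\|\phi\|)\subset\mathcal C_r\}$ contains a nonzero vector. The constants $K_r,\vartheta_r,\rho_r^{-1}$ are bounded on compact subsets of $(0,r_0]$. For $0<s<r\le r_0$ there are continuous linear injections $j_{s,r}:E_r\to E_s$, bounded in norm uniformly in $s,r$, with $j_{t,s}j_{s,r}=j_{t,r}$ for $t<s<r$, $j_{s,r}(\mathcal C_r)\subset \mathcal C_s$ and $\ell_r=\ell_s\circ j_{s,r}$. Let $(\Omega,\mathcal F,\mathbb P)$ be a probability space and $\tau:\Omega\to\Omega$ an invertible (bimeasurable),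 measure-preserving, ergodic map. Let $X_r=L^\infty(\Omega;E_r)$ be the Banach space of bounded Bochner-measurable maps $\Omega\to E_r$ with the norm $\sup_\omega\|\phi_\omega\|$ (maps are not identified almost everywhere), and let $\mathcal S_r\subset X_r$ be the set of $\phi$ with $\phi_\omega\in\mathcal C_r(\rho_r)$ and $\langle\ell_r,\phi_\omega\rangle=1$ for all $\omega$. The maps $j_{s,r}$ act fibrewise as $j_{s,r}:X_r\to X_s$. Let $U$ be an open convex subset of a real Banach space $\mathcal B$. For each $r\in(0,r_0]$, $u\in U$, $\omega\in\Omega$ let $\mathcal L_{r,u,\omega}\in L(E_r)$ satisfy $\mathcal L_{r,u,\omega}(\mathcal C_r\setminus\{0\})\subset\mathcal C_r(\rho_r)\setminus\{0\}$ and $\vartheta_r^{-1}\le\|\mathcal L_{r,u,\omega}\|\le\vartheta_r$, let $\omega\mapsto\mathcal L_{r,u,\omega}x$ be Bochner measurable for every $x\in E_r$, and let $j_{s,r}\mathcal L_{r,u,\omega}=\mathcal L_{s,u,\omega}j_{s,r}$ for $s<r$. Define $L_{r,u}\in L(X_r)$ by $(L_{r,u}\phi)_\omega=\mathcal L_{r,u,\tau^{-1}\omega}\phi_{\tau^{-1}\omega}$,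 and set $\Lambda_{r,u}(\phi)=\langle\ell_r,L_{r,u}\phi\rangle\in L^\infty(\Omega;\mathbb R)$ and $\pi_{r,u}(\phi)=\Lambda_{r,u}(\phi)^{-1}L_{r,u}\phi$, which maps $\mathcal S_r$ to itself. Assume that for all $0<s<r\le r_0$ and $t\in[0,r-s)$ the map $u\in U\mapsto L_{s,u}j_{s,r}\in L(X_r,X_s)$ is $C^t$. (For $t=k+\alpha$ with $k\in\mathbb N_0$, $\alpha\in(0,1]$, this means: $k$ times continuously Fréchet differentiable with locally $\alpha$-Hölder $k$-th derivative; for $t=0$: continuous.) For $\phi\in\mathcal S_s$ define $Q_{s,u}(\phi)\in L(X_s)$ by $$Q_{s,u}(\phi)z=\Lambda_{s,u}(\phi)^{-1}\bigl(L_{s,u}z-\Lambda_{s,u}(z)\,\pi_{s,u}(\phi)\bigr),$$ and for $0<s<r-1$ and $\phi\in\mathcal S_r$ define $P_{s,r,u}(\phi)\in L(\mathcal B,X_s)$ by $$P_{s,r,u}(\phi)=\Lambda_{r,u}(\phi)^{-1}\Bigl(\partial_u\bigl(j_{s,r}L_{r,u}\phi\bigr)-\bigl(\partial_u\Lambda_{r,u}(\phi)\bigr)\,j_{s,r}\pi_{r,u}(\phi)\Bigr).$$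 **Theorem.** There is a unique family $f_r:U\to\mathcal S_r$, $r\in(0,r_0]$, such that $f_s(u)=j_{s,r}f_r(u)$ for all $s<r$ and $f_r(u)=\pi_{r,u}(f_r(u))$ for all $r$ and $u\in U$. For every $0<s<r_0-1$ and $u\in U$: 1. with $\phi=f_{r_0}(u)$ held fixed, $v\mapsto j_{s,r_0}\pi_{r_0,v}(\phi)\in X_s$ is Fréchet differentiable at $v=u$ with derivative $P_{s,r_0,u}(\phi)$; 2. $1-Q_{s,u}(f_s(u))$ is invertible in $L(X_s)$; 3. $v\in U\mapsto f_s(v)\in X_s$ is Fréchet differentiable at $u$, with derivative $$D_uf_s(u)=\bigl(1-Q_{s,u}(f_s(u))\bigr)^{-1}P_{s,r_0,u}(f_{r_0}(u))\in L(\mathcal B,X_s).$$ -/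

import Mathlib

open MeasureTheory

/-! ## Bounded Bochner-measurable sections -/

/-- `L^∞(Ω; E)`: the everywhere bounded, Bochner-measurable maps `Ω → E` (measurable with
separable range, i.e. uniform limits of countably-valued measurable maps), with the genuine
supremum norm `sup_ω ‖φ ω‖`; maps are not identified almost everywhere. -/
def SectionSpace (Ω : Type*) [MeasurableSpace Ω] (E : Type*) [NormedAddCommGroup E]
    [NormedSpace ℝ E] : Submodule ℝ (lp (fun _ : Ω => E) ⊤) where
  carrier := {f | StronglyMeasurable (fun ω => f ω)}
  add_mem' := fun {f g} hf hg => by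
    have : (fun ω => (f + g) ω) = fun ω => f ω + g ω := by ext ω; simp
    change StronglyMeasurable _
    rw [this]
    exact StronglyMeasurable.add hf hg
  zero_mem' := by
    have : (fun ω => (0 : lp (fun _ : Ω => E) ⊤) ω) = fun _ : Ω => (0 : E) := by ext ω; simp
    change StronglyMeasurable _
    rw [this]
    exact stronglyMeasurable_const
  smul_mem' := fun c f hf => by
    have : (fun ω => (c • f) ω) = fun ω => c • f ω := by ext ω; simp
    change StronglyMeasurable _
    rw [this]
    exact StronglyMeasurable.const_smul hf c

namespace SectionSpace

variable {Ω : Type*} [MeasurableSpace Ω] {E : Type*} [NormedAddCommGroup E] [NormedSpace ℝ E]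
  {F : Type*} [NormedAddCommGroup F] [NormedSpace ℝ F]

theorem stronglyMeasurable (φ : SectionSpace Ω E) : StronglyMeasurable (fun ω => φ.val ω) := φ.2

theorem norm_val_le (φ : SectionSpace Ω E) (ω : Ω) : ‖φ.val ω‖ ≤ ‖φ‖ :=
  lp.norm_apply_le_norm ENNReal.top_ne_zero φ.1 ω

theorem norm_le (φ : SectionSpace Ω E) {C : ℝ} (hC : 0 ≤ C) (h : ∀ ω, ‖φ.val ω‖ ≤ C) :
    ‖φ‖ ≤ C :=
  lp.norm_le_of_forall_le hC h

@[ext] theorem ext {φ ψ : SectionSpace Ω E} (h : ∀ ω, φ.val ω = ψ.val ω) : φ = ψ :=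
  Subtype.ext (lp.ext (funext h))

@[simp] theorem val_add (φ ψ : SectionSpace Ω E) (ω : Ω) :
    (φ + ψ).val ω = φ.val ω + ψ.val ω := by simp

@[simp] theorem val_sub (φ ψ : SectionSpace Ω E) (ω : Ω) :
    (φ - ψ).val ω = φ.val ω - ψ.val ω := by simp

@[simp] theorem val_smul (c : ℝ) (φ : SectionSpace Ω E) (ω : Ω) :
    (c • φ).val ω = c • φ.val ω := by simp

/-- The section given by a bounded, Bochner-measurable map. -/
def mk (f : Ω → E) (hf : StronglyMeasurable f) (hb : ∃ C, ∀ ω, ‖f ω‖ ≤ C) :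
    SectionSpace Ω E :=
  ⟨⟨f, memℓp_infty (by
    obtain ⟨C, hC⟩ := hb
    exact ⟨C, by rintro _ ⟨ω, rfl⟩; exact hC ω⟩)⟩, hf⟩

@[simp] theorem val_mk (f : Ω → E) (hf : StronglyMeasurable f) (hb : ∃ C, ∀ ω, ‖f ω‖ ≤ C)
    (ω : Ω) : (mk f hf hb).val ω = f ω := rfl

/-- `A : Ω → L(E, F)` is strongly Bochner measurable and bounded. -/
structure BoundedField (A : Ω → E →L[ℝ] F) : Prop where
  meas : ∀ x : E, StronglyMeasurable (fun ω => A ω x)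
  bdd : ∃ C, ∀ ω, ‖A ω‖ ≤ C

theorem BoundedField.stronglyMeasurable_apply {A : Ω → E →L[ℝ] F} (hA : BoundedField A)
    {f : Ω → E} (hf : StronglyMeasurable f) : StronglyMeasurable (fun ω => A ω (f ω)) := by
  have hs : ∀ g : SimpleFunc Ω E, StronglyMeasurable (fun ω => A ω (g ω)) := by
    intro g
    have : (fun ω => A ω (g ω)) =
        fun ω => ∑ y ∈ g.range, (g ⁻¹' {y}).indicator (fun ω => A ω y) ω := by
      ext ω
      rw [Finset.sum_eq_single (g ω)]
      · simp
      · intro b _ hb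
        exact Set.indicator_of_notMem (by simpa using hb.symm) _
      · intro h
        exact absurd (g.mem_range_self ω) h
    rw [this]
    exact Finset.stronglyMeasurable_fun_sum _
      (fun y _ => (hA.meas y).indicator (g.measurableSet_fiber y))
  refine stronglyMeasurable_of_tendsto Filter.atTop (fun n => hs (hf.approx n)) ?_
  rw [tendsto_pi_nhds]
  intro ω
  exact ((A ω).continuous.tendsto _).comp (hf.tendsto_approx ω)

/-- The operator `L^∞(Ω; E) → L^∞(Ω; F)` acting fibrewise: `(A φ)_ω = A_ω φ_ω`. -/
noncomputable def fiberMap (A : Ω → E →L[ℝ] F) (hA : BoundedField A) :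
    SectionSpace Ω E →L[ℝ] SectionSpace Ω F :=
  LinearMap.mkContinuousOfExistsBound
    { toFun := fun φ => mk (fun ω => A ω (φ.val ω))
        (hA.stronglyMeasurable_apply (stronglyMeasurable φ)) (by
          obtain ⟨C, hC⟩ := hA.bdd
          exact ⟨C * ‖φ‖, fun ω => (A ω).le_of_opNorm_le_of_le (hC ω) (norm_val_le φ ω)⟩)
      map_add' := fun φ ψ => by ext ω; simp
      map_smul' := fun c φ => by ext ω; simp }
    (by
      obtain ⟨C, hC⟩ := hA.bdd
      refine ⟨|C|, fun φ => norm_le _ (by positivity) fun ω => ?_⟩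
      exact (A ω).le_of_opNorm_le_of_le ((hC ω).trans (le_abs_self C)) (norm_val_le φ ω))

@[simp] theorem fiberMap_val (A : Ω → E →L[ℝ] F) (hA : BoundedField A) (φ : SectionSpace Ω E)
    (ω : Ω) : (fiberMap A hA φ).val ω = A ω (φ.val ω) := rfl

theorem boundedField_const (T : E →L[ℝ] F) : BoundedField (fun _ : Ω => T) :=
  ⟨fun _ => stronglyMeasurable_const, ‖T‖, fun _ => le_rfl⟩

theorem boundedField_smulRight (p : SectionSpace Ω E) :
    BoundedField (fun ω => (ContinuousLinearMap.id ℝ ℝ).smulRight (p.val ω)) :=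
  ⟨fun x => StronglyMeasurable.const_smul (stronglyMeasurable p) x, ‖p‖, fun ω => by
    rw [ContinuousLinearMap.norm_smulRight_apply]
    exact (mul_le_of_le_one_left (norm_nonneg _) ContinuousLinearMap.norm_id_le).trans
      (norm_val_le p ω)⟩

theorem boundedField_inv {g : SectionSpace Ω ℝ} (hg : ∃ c > 0, ∀ ω, c ≤ g.val ω) :
    BoundedField (fun ω => (g.val ω)⁻¹ • ContinuousLinearMap.id ℝ E) := by
  refine ⟨fun x => ?_, ?_⟩
  · simpa using ((stronglyMeasurable g).inv₀).smul_const x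
  · obtain ⟨c, hc, h⟩ := hg
    refine ⟨c⁻¹, fun ω => ?_⟩
    rw [norm_smul, norm_inv, Real.norm_of_nonneg (hc.le.trans (h ω))]
    calc (g.val ω)⁻¹ * ‖ContinuousLinearMap.id ℝ E‖ ≤ c⁻¹ * 1 :=
          mul_le_mul (inv_anti₀ hc (h ω)) ContinuousLinearMap.norm_id_le (norm_nonneg _)
            (inv_nonneg.2 hc.le)
      _ = c⁻¹ := mul_one _

/-- Fibrewise multiplication `g ↦ g p` of real sections by a fixed section `p`. -/
noncomputable def smulSection (p : SectionSpace Ω E) :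
    SectionSpace Ω ℝ →L[ℝ] SectionSpace Ω E :=
  fiberMap _ (boundedField_smulRight p)

@[simp] theorem smulSection_val (p : SectionSpace Ω E) (g : SectionSpace Ω ℝ) (ω : Ω) :
    (smulSection p g).val ω = g.val ω • p.val ω := rfl

/-- Fibrewise multiplication by `g⁻¹`, for a real section `g` bounded below by a positive
constant. -/
noncomputable def invMul (g : SectionSpace Ω ℝ) (hg : ∃ c > 0, ∀ ω, c ≤ g.val ω) :
    SectionSpace Ω E →L[ℝ] SectionSpace Ω E :=
  fiberMap _ (boundedField_inv hg)

@[simp] theorem invMul_val (g : SectionSpace Ω ℝ) (hg : ∃ c > 0, ∀ ω, c ≤ g.val ω)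
    (φ : SectionSpace Ω E) (ω : Ω) : (invMul g hg φ).val ω = (g.val ω)⁻¹ • φ.val ω := rfl

/-- Transport of sections along the base map: `φ ↦ φ ∘ τ⁻¹`. -/
noncomputable def shift (τ : Ω ≃ᵐ Ω) : SectionSpace Ω E →L[ℝ] SectionSpace Ω E :=
  LinearMap.mkContinuous
    { toFun := fun φ => mk (fun ω => φ.val (τ.symm ω))
        ((stronglyMeasurable φ).comp_measurable τ.symm.measurable)
        ⟨‖φ‖, fun ω => norm_val_le φ _⟩
      map_add' := fun φ ψ => by ext ω; simp
      map_smul' := fun c φ => by ext ω; simp } 1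
    (fun φ => norm_le _ (by positivity) fun ω => by simpa using norm_val_le φ (τ.symm ω))

@[simp] theorem shift_val (τ : Ω ≃ᵐ Ω) (φ : SectionSpace Ω E) (ω : Ω) :
    (shift τ φ).val ω = φ.val (τ.symm ω) := rfl

end SectionSpace

/-! ## Regular cones and cone contractions -/

/-- A regular Birkhoff cone in a real Banach space together with its constants `ρ, K, ϑ` and
the normalizing functional `ℓ`. (`ProperCone` is Mathlib's closed convex pointed cone.) -/
structure ConeSystem (E : Type*) [NormedAddCommGroup E] [NormedSpace ℝ E] where
  cone : ProperCone ℝ E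
  ρ : ℝ
  K : ℝ
  ϑ : ℝ
  ℓ : E →L[ℝ] ℝ
  salient : ∀ x ∈ cone, -x ∈ cone → x = 0
  ρ_pos : 0 < ρ
  ρ_le_one : ρ ≤ 1
  one_le_K : 1 ≤ K
  one_le_ϑ : 1 ≤ ϑ
  norm_ℓ : ‖ℓ‖ = 1
  /-- outer regularity -/
  outer : ∀ x ∈ cone, K⁻¹ * ‖x‖ ≤ ℓ x
  /-- inner regularity: the sub-cone `C(ρ)` is non-trivial -/
  inner : ∃ x ∈ cone, x ≠ 0 ∧ Metric.closedBall x (ρ * ‖x‖) ⊆ (cone : Set E)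

namespace ConeSystem

variable {E : Type*} [NormedAddCommGroup E] [NormedSpace ℝ E]

/-- The sub-cone `C(ρ) = {x ∈ C : B(x, ρ‖x‖) ⊆ C}`. -/
def innerCone (S : ConeSystem E) : Set E :=
  {x | x ∈ S.cone ∧ Metric.closedBall x (S.ρ * ‖x‖) ⊆ (S.cone : Set E)}

/-- The operators allowed in a cocycle: uniform contraction `L(C \ {0}) ⊆ C(ρ) \ {0}` and the
uniform bounds `1/ϑ ≤ ‖L‖ ≤ ϑ`. -/
structure IsContraction (S : ConeSystem E) (L : E →L[ℝ] E) : Prop where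
  maps : ∀ x ∈ S.cone, x ≠ 0 → L x ∈ S.innerCone ∧ L x ≠ 0
  lower : S.ϑ⁻¹ ≤ ‖L‖
  upper : ‖L‖ ≤ S.ϑ

theorem one_le_norm (S : ConeSystem E) {x : E} (hx : S.ℓ x = 1) : 1 ≤ ‖x‖ := by
  have h := S.ℓ.le_opNorm x
  rwa [S.norm_ℓ, one_mul, hx, norm_one] at h

theorem norm_le_K (S : ConeSystem E) {x : E} (hx : x ∈ S.cone) (h1 : S.ℓ x = 1) :
    ‖x‖ ≤ S.K := by
  have h := S.outer x hx
  rw [h1, inv_mul_le_iff₀ (zero_lt_one.trans_le S.one_le_K), mul_one] at h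
  exact h

theorem K_pos (S : ConeSystem E) : 0 < S.K := zero_lt_one.trans_le S.one_le_K

theorem ϑ_pos (S : ConeSystem E) : 0 < S.ϑ := zero_lt_one.trans_le S.one_le_ϑ

theorem smul_mem_innerCone (S : ConeSystem E) {x : E} (hx : x ∈ S.innerCone) {c : ℝ}
    (hc : 0 < c) : c • x ∈ S.innerCone := by
  refine ⟨S.cone.smul_mem hx.1 hc.le, fun y hy => ?_⟩
  have h1 : c⁻¹ • y ∈ S.cone := by
    apply hx.2
    rw [mem_closedBall_iff_norm] at hy ⊢
    have h2 : c⁻¹ • y - x = c⁻¹ • (y - c • x) := by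
      rw [smul_sub, smul_smul, inv_mul_cancel₀ hc.ne', one_smul]
    rw [h2, norm_smul, norm_inv, Real.norm_of_nonneg hc.le, inv_mul_le_iff₀ hc]
    rw [norm_smul, Real.norm_of_nonneg hc.le] at hy
    exact hy.trans (le_of_eq (by ring))
  have h3 := S.cone.smul_mem h1 hc.le
  rwa [smul_smul, mul_inv_cancel₀ hc.ne', one_smul] at h3

/-- Contractions are bounded below on the normalized inner cone. -/
theorem IsContraction.le_ℓ {S : ConeSystem E} {L : E →L[ℝ] E} (hL : S.IsContraction L) {x : E}
    (hx : x ∈ S.innerCone) (h1 : S.ℓ x = 1) : S.ρ / (S.ϑ * S.K) ≤ S.ℓ (L x) := by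
  have hmaps : ∀ y ∈ S.cone, L y ∈ S.cone := fun y hy => by
    by_cases h0 : y = 0
    · rw [h0, map_zero]; exact zero_mem S.cone
    · exact (hL.maps y hy h0).1.1
  have hxn := S.one_le_norm h1
  have hx0 : 0 < ‖x‖ := zero_lt_one.trans_le hxn
  have hK := S.K_pos
  have hρ := S.ρ_pos
  have hϑ := S.ϑ_pos
  have hpos : 0 ≤ S.ℓ (L x) :=
    (by positivity : 0 ≤ S.K⁻¹ * ‖L x‖).trans (S.outer _ (hmaps x hx.1))
  have key : ∀ w : E, ‖w‖ ≤ S.ρ * ‖x‖ → ‖L w‖ ≤ S.K * S.ℓ (L x) := by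
    intro w hw
    have ha : L (x + w) ∈ S.cone :=
      hmaps _ (hx.2 (by simpa [mem_closedBall_iff_norm] using hw))
    have hb : L (x - w) ∈ S.cone :=
      hmaps _ (hx.2 (by simpa [mem_closedBall_iff_norm] using hw))
    have ha' := S.outer _ ha
    have hb' := S.outer _ hb
    rw [inv_mul_le_iff₀ hK] at ha' hb'
    have h2 : (2 : ℝ) • L w = L (x + w) - L (x - w) := by
      rw [← map_sub, ← map_smul]; congr 1; rw [two_smul]; abel
    have h3 : 2 * ‖L w‖ ≤ ‖L (x + w)‖ + ‖L (x - w)‖ := by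
      have h4 := norm_sub_le (L (x + w)) (L (x - w))
      rw [← h2, norm_smul, Real.norm_of_nonneg zero_le_two] at h4
      exact h4
    simp only [map_add, map_sub] at ha' hb' h3
    linarith
  have hbound : ‖L‖ ≤ S.K * S.ℓ (L x) / S.ρ := by
    refine L.opNorm_le_bound (by positivity) fun w => ?_
    by_cases hw : w = 0
    · simp [hw]
    have hw0 : 0 < ‖w‖ := norm_pos_iff.2 hw
    have h5 := key ((S.ρ / ‖w‖) • w) (by
      rw [norm_smul, norm_div, norm_norm, Real.norm_of_nonneg hρ.le, div_mul_cancel₀ _ hw0.ne']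
      exact le_mul_of_one_le_right hρ.le hxn)
    rw [map_smul, norm_smul, norm_div, norm_norm, Real.norm_of_nonneg hρ.le] at h5
    have h6 : ‖L w‖ = (S.ρ / ‖w‖ * ‖L w‖) * ‖w‖ / S.ρ := by field_simp
    rw [h6, div_mul_eq_mul_div (S.K * S.ℓ (L x))]
    exact div_le_div_of_nonneg_right (mul_le_mul_of_nonneg_right h5 hw0.le) hρ.le
  have h7 : S.ϑ⁻¹ ≤ S.K * S.ℓ (L x) / S.ρ := hL.lower.trans hbound
  rw [le_div_iff₀ hρ, inv_mul_le_iff₀ hϑ] at h7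
  rw [div_le_iff₀ (by positivity)]
  linarith

end ConeSystem

/-- The sections with values in `C_{ℓ=1}(ρ)`; they are automatically bounded. -/
def NormalizedSection (Ω : Type*) [MeasurableSpace Ω] {E : Type*} [NormedAddCommGroup E]
    [NormedSpace ℝ E] (S : ConeSystem E) : Type _ :=
  {φ : SectionSpace Ω E // ∀ ω, φ.val ω ∈ S.innerCone ∧ S.ℓ (φ.val ω) = 1}

/-! ## Graded families of Banach spaces with cones -/

/-- Regular cones in a scale `(E_r)`, `0 < r ≤ r₀`, of Banach spaces, with the continuous
linear downgrading injections `j s r : E_r → E_s`, `s < r`. -/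
structure GradedConeFamily (r₀ : ℝ) (E : Set.Ioc (0 : ℝ) r₀ → Type*)
    [∀ r, NormedAddCommGroup (E r)] [∀ r, NormedSpace ℝ (E r)] where
  sys : ∀ r, ConeSystem (E r)
  j : ∀ s r, s < r → E r →L[ℝ] E s
  j_injective : ∀ s r (h : s < r), Function.Injective (j s r h)
  j_bound : ∃ C : ℝ, ∀ s r (h : s < r), ‖j s r h‖ ≤ C
  j_trans : ∀ t s r (hts : t < s) (hsr : s < r) (x : E r),
    j t s hts (j s r hsr x) = j t r (hts.trans hsr) x
  j_cone : ∀ s r (h : s < r), ∀ x ∈ (sys r).cone, j s r h x ∈ (sys s).cone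
  ℓ_comp : ∀ s r (h : s < r) (x : E r), (sys r).ℓ x = (sys s).ℓ (j s r h x)
  /-- the constants are bounded on every compact subset of `(0, r₀]` -/
  const_bound : ∀ T : Set ℝ, IsCompact T → T ⊆ Set.Ioc 0 r₀ → ∃ C : ℝ,
    ∀ r : Set.Ioc (0 : ℝ) r₀, (r : ℝ) ∈ T → (sys r).K ≤ C ∧ (sys r).ϑ ≤ C ∧ (sys r).ρ⁻¹ ≤ C

/-- A family of cone-contracting cocycles `L_{r,u}` over the levels of a graded family, depending
on a parameter `u ∈ U` and commuting with the downgrading injections. -/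
structure GradedCocycle {r₀ : ℝ} {E : Set.Ioc (0 : ℝ) r₀ → Type*}
    [∀ r, NormedAddCommGroup (E r)] [∀ r, NormedSpace ℝ (E r)] (G : GradedConeFamily r₀ E)
    (Ω : Type*) [MeasurableSpace Ω] {B : Type*} (U : Set B) where
  op : ∀ r, U → Ω → E r →L[ℝ] E r
  contraction : ∀ r u ω, (G.sys r).IsContraction (op r u ω)
  meas : ∀ r u (x : E r), StronglyMeasurable (fun ω => op r u ω x)
  comm : ∀ s r (h : s < r) u ω (x : E r), G.j s r h (op r u ω x) = op s u ω (G.j s r h x)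

/-- Extension by zero of a map defined on `U` (used for maps on an open set `U`, where the
values outside `U` are irrelevant for derivatives at points of `U`). -/
noncomputable def zeroExtend {B Y : Type*} [Zero Y] (U : Set B) (f : U → Y) (v : B) : Y :=
  open Classical in if h : v ∈ U then f ⟨v, h⟩ else 0

/-- `f` is of class `C^t` on `U`, for real `t ≥ 0`. If `t = k + α` with `k ∈ ℕ` and `0 < α ≤ 1`,
this means that `f` is `k` times continuously differentiable on `U` and that its `k`-th
derivative is locally `α`-Hölder; for `t = 0` it means that `f` is continuous. -/
def IsOfClass {B Y : Type*} [NormedAddCommGroup B] [NormedSpace ℝ B] [NormedAddCommGroup Y]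
    [NormedSpace ℝ Y] (t : ℝ) (f : B → Y) (U : Set B) : Prop :=
  ContDiffOn ℝ (⌈t⌉₊ - 1 : ℕ) f U ∧
    ∀ x ∈ U, ∃ C : ℝ, ∃ ε > 0, ∀ y ∈ U ∩ Metric.ball x ε, ∀ z ∈ U ∩ Metric.ball x ε,
      ‖iteratedFDerivWithin ℝ (⌈t⌉₊ - 1) f U y - iteratedFDerivWithin ℝ (⌈t⌉₊ - 1) f U z‖ ≤
        C * ‖y - z‖ ^ (t - (⌈t⌉₊ - 1 : ℕ))

namespace GradedCocycle

variable {r₀ : ℝ} {E : Set.Ioc (0 : ℝ) r₀ → Type*}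
  [∀ r, NormedAddCommGroup (E r)] [∀ r, NormedSpace ℝ (E r)] {G : GradedConeFamily r₀ E}
  {Ω : Type*} [MeasurableSpace Ω] {B : Type*} {U : Set B}

theorem boundedField (A : GradedCocycle G Ω U) (r : Set.Ioc (0 : ℝ) r₀) (u : U) :
    SectionSpace.BoundedField (A.op r u) :=
  ⟨A.meas r u, (G.sys r).ϑ, fun ω => (A.contraction r u ω).upper⟩

/-- The operator on `X_r = L^∞(Ω; E_r)`: `(L φ)_ω = L_{τ⁻¹ω} φ_{τ⁻¹ω}`. -/
noncomputable def opX (A : GradedCocycle G Ω U) (τ : Ω ≃ᵐ Ω) (r : Set.Ioc (0 : ℝ) r₀) (u : U) :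
    SectionSpace Ω (E r) →L[ℝ] SectionSpace Ω (E r) :=
  (SectionSpace.shift τ).comp (SectionSpace.fiberMap (A.op r u) (A.boundedField r u))

/-- The normalizing field `Λ_{r,u}(φ) = ⟨ℓ_r, L_{r,u} φ⟩`. -/
noncomputable def Lam (A : GradedCocycle G Ω U) (τ : Ω ≃ᵐ Ω) (r : Set.Ioc (0 : ℝ) r₀) (u : U) :
    SectionSpace Ω (E r) →L[ℝ] SectionSpace Ω ℝ :=
  (SectionSpace.fiberMap (fun _ => (G.sys r).ℓ)
    (SectionSpace.boundedField_const _)).comp (A.opX τ r u)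

/-- The downgrading `X_r → X_s`, acting fibrewise. -/
noncomputable def down (_A : GradedCocycle G Ω U) (s r : Set.Ioc (0 : ℝ) r₀) (h : s < r) :
    SectionSpace Ω (E r) →L[ℝ] SectionSpace Ω (E s) :=
  SectionSpace.fiberMap (fun _ => G.j s r h) (SectionSpace.boundedField_const _)

theorem Lam_val (A : GradedCocycle G Ω U) (τ : Ω ≃ᵐ Ω) (r : Set.Ioc (0 : ℝ) r₀) (u : U)
    (φ : SectionSpace Ω (E r)) (ω : Ω) : (A.Lam τ r u φ).val ω =
      (G.sys r).ℓ (A.op r u (τ.symm ω) (φ.val (τ.symm ω))) := rfl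

theorem Lam_pos (A : GradedCocycle G Ω U) (τ : Ω ≃ᵐ Ω) (r : Set.Ioc (0 : ℝ) r₀) (u : U)
    (φ : NormalizedSection Ω (G.sys r)) : ∃ c > 0, ∀ ω, c ≤ (A.Lam τ r u φ.1).val ω := by
  have hK := (G.sys r).K_pos
  have hρ := (G.sys r).ρ_pos
  have hϑ := (G.sys r).ϑ_pos
  exact ⟨(G.sys r).ρ / ((G.sys r).ϑ * (G.sys r).K), by positivity, fun ω =>
    (A.contraction r u (τ.symm ω)).le_ℓ (φ.2 (τ.symm ω)).1 (φ.2 (τ.symm ω)).2⟩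

/-- The fractional linear map `π_{r,u}(φ) = Λ_{r,u}(φ)⁻¹ L_{r,u} φ`. -/
noncomputable def pi (A : GradedCocycle G Ω U) (τ : Ω ≃ᵐ Ω) (r : Set.Ioc (0 : ℝ) r₀) (u : U)
    (φ : NormalizedSection Ω (G.sys r)) : NormalizedSection Ω (G.sys r) :=
  ⟨SectionSpace.invMul (A.Lam τ r u φ.1) (A.Lam_pos τ r u φ) (A.opX τ r u φ.1), fun ω => by
    obtain ⟨c, hc, h⟩ := A.Lam_pos τ r u φ
    have hpos : 0 < (A.Lam τ r u φ.1).val ω := hc.trans_le (h ω)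
    have hφ := φ.2 (τ.symm ω)
    have hne : φ.1.val (τ.symm ω) ≠ 0 := fun h0 => by
      have := hφ.2
      simp [h0] at this
    refine ⟨(G.sys r).smul_mem_innerCone
      ((A.contraction r u (τ.symm ω)).maps _ hφ.1.1 hne).1 (inv_pos.2 hpos), ?_⟩
    rw [SectionSpace.invMul_val, map_smul, smul_eq_mul]
    exact inv_mul_cancel₀ hpos.ne'⟩

/-- A parametrized family of fields `f_r(u) ∈ C_{r,ℓ_r=1}(Ω)` that is consistent along the scale
and fixed by the maps `π_{r,u}`. -/
structure IsFixedFamily (A : GradedCocycle G Ω U) (τ : Ω ≃ᵐ Ω)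
    (f : ∀ r, U → NormalizedSection Ω (G.sys r)) : Prop where
  consistent : ∀ s r (h : s < r) (u : U), (f s u).1 = A.down s r h (f r u).1
  fixed : ∀ r (u : U), f r u = A.pi τ r u (f r u)

/-- `Q_{s,u}(φ) z = Λ(φ)⁻¹ (L z - Λ(z) π(φ))`, the derivative of `π_{s,u}` at `φ`. -/
noncomputable def Q (A : GradedCocycle G Ω U) (τ : Ω ≃ᵐ Ω) (s : Set.Ioc (0 : ℝ) r₀) (u : U)
    (φ : NormalizedSection Ω (G.sys s)) : SectionSpace Ω (E s) →L[ℝ] SectionSpace Ω (E s) :=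
  (SectionSpace.invMul (A.Lam τ s u φ.1) (A.Lam_pos τ s u φ)).comp
    (A.opX τ s u - (SectionSpace.smulSection (A.pi τ s u φ).1).comp (A.Lam τ s u))

variable [NormedAddCommGroup B] [NormedSpace ℝ B]

/-- `∂_u (j L_u φ) ∈ L(B, X_s)` for `φ ∈ X_r`, `s < r`. -/
noncomputable def dOp (A : GradedCocycle G Ω U) (τ : Ω ≃ᵐ Ω) (s r : Set.Ioc (0 : ℝ) r₀)
    (h : s < r) (u : U) (φ : SectionSpace Ω (E r)) : B →L[ℝ] SectionSpace Ω (E s) :=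
  fderiv ℝ (zeroExtend U fun v => A.down s r h (A.opX τ r v φ)) u

/-- `∂_u Λ_u(φ) ∈ L(B, L^∞(Ω))` for `φ ∈ X_r`. -/
noncomputable def dLam (A : GradedCocycle G Ω U) (τ : Ω ≃ᵐ Ω) (r : Set.Ioc (0 : ℝ) r₀)
    (u : U) (φ : SectionSpace Ω (E r)) : B →L[ℝ] SectionSpace Ω ℝ :=
  fderiv ℝ (zeroExtend U fun v => A.Lam τ r v φ) u

/-- `P_{s,r,u}(φ) = Λ_u(φ)⁻¹ (∂_u (j L_u φ) - (∂_u Λ_u(φ)) j π_u(φ)) ∈ L(B, X_s)`. -/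
noncomputable def P (A : GradedCocycle G Ω U) (τ : Ω ≃ᵐ Ω) (s r : Set.Ioc (0 : ℝ) r₀)
    (h : s < r) (u : U) (φ : NormalizedSection Ω (G.sys r)) :
    B →L[ℝ] SectionSpace Ω (E s) :=
  (SectionSpace.invMul (A.Lam τ r u φ.1) (A.Lam_pos τ r u φ)).comp
    (A.dOp τ s r h u φ.1 -
      (SectionSpace.smulSection (A.down s r h (A.pi τ r u φ).1)).comp (A.dLam τ r u φ.1))

end GradedCocycle

/-! Everything rests on a Birkhoff-type contraction with constants uniform in `ω`. If `a x ≤ z ≤ b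
x` in the cone order, then `L z` lies between multiples of `L x` whose gap is smaller by the factor
`rate < 1` (`IsContraction.shrink`). Order intervals thus play the role of the Hilbert metric.
Iterating over all fibres at once, `Lⁿ z` becomes proportional to `Lⁿ φ` exponentially fast in the
supremum norm.

This has two consequences at each level. The iterates of `π_u` contract exponentially, which gives
the unique fixed section `f_r(u)`; uniqueness also forces consistency along the scale. At the fixed
section, `Qⁿ` for `n ≥ 1` is the normalized part of `Lⁿ` transversal to `f`, so it tends to zero in
norm and `1 - Q` is invertible.

For the derivative, put `k = f_s(v) - f_s(u)` and `y = (L_v - L_u) f_s(v)`. The eigenvalue equations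
at `u` and `v` give `(1 - Q) k = T y` up to an error bounded by a multiple of `(‖k‖ + ‖y‖) ‖k‖`,
where `T` is the derivative of the normalization `w ↦ w / ℓ(w)` (`norm_linearization_le`). The
contraction also gives `‖k‖ ≤ C ‖y‖`, so it remains to differentiate `y`.

The scale serves this last point. Choose `r` with `s + 1 < r < r₀` and write `f_s(v) = j f_r(v)`.
The operators `L_{s,v} j_{s,r}` are `C¹` in `v`, and `f_r` is continuous because `L_{r,v} j_{r,r₀}`
is continuous and `f_{r₀}` is bounded. A `C¹` family of operators applied to a continuous family of
vectors makes `y` differentiable at `u`, since `y` already contains the factor `L_v - L_u`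
(`exists_hasFDerivAt_apply`). -/

/-! ### Cone contraction through order intervals. -/

namespace ConeSystem

variable {E : Type*} [NormedAddCommGroup E] [NormedSpace ℝ E]

/-- The contraction rate of the operators allowed in a cocycle. -/
noncomputable def rate (S : ConeSystem E) : ℝ := 1 - S.ρ / (2 * S.K)

theorem rate_lt_one (S : ConeSystem E) : S.rate < 1 := by
  have := div_pos S.ρ_pos (mul_pos two_pos S.K_pos)
  unfold rate; linarith

theorem half_ρ_div_K_le (S : ConeSystem E) : S.ρ / (2 * S.K) ≤ 1 / 2 := by
  have hK := S.K_pos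
  rw [div_le_div_iff₀ (by positivity) two_pos]
  linarith [S.ρ_le_one, S.one_le_K]

theorem rate_pos (S : ConeSystem E) : 0 < S.rate := by
  have := S.half_ρ_div_K_le
  unfold rate; linarith

theorem ℓ_le_norm (S : ConeSystem E) (x : E) : |S.ℓ x| ≤ ‖x‖ := by
  simpa [S.norm_ℓ] using S.ℓ.le_opNorm x

theorem norm_le_K_mul (S : ConeSystem E) {x : E} (hx : x ∈ S.cone) : ‖x‖ ≤ S.K * S.ℓ x := by
  have h := S.outer x hx
  rwa [inv_mul_le_iff₀ S.K_pos] at h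

theorem ℓ_nonneg (S : ConeSystem E) {x : E} (hx : x ∈ S.cone) : 0 ≤ S.ℓ x :=
  (mul_nonneg (inv_nonneg.2 S.K_pos.le) (norm_nonneg x)).trans (S.outer x hx)

theorem ℓ_pos (S : ConeSystem E) {x : E} (hx : x ∈ S.cone) (h0 : x ≠ 0) : 0 < S.ℓ x :=
  (mul_pos (inv_pos.2 S.K_pos) (norm_pos_iff.2 h0)).trans_le (S.outer x hx)

theorem zero_mem_innerCone (S : ConeSystem E) : (0 : E) ∈ S.innerCone := by
  refine ⟨zero_mem S.cone, fun y hy => ?_⟩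
  have : y = 0 := by simpa using hy
  rw [this]
  exact zero_mem S.cone

theorem add_mem_of_mem_innerCone (S : ConeSystem E) {x w : E} (hx : x ∈ S.innerCone)
    (hw : ‖w‖ ≤ S.ρ * ‖x‖) : x + w ∈ S.cone :=
  hx.2 (by simpa [mem_closedBall_iff_norm] using hw)

theorem smul_add_mem (S : ConeSystem E) {x w : E} (hx : x ∈ S.innerCone) {c : ℝ} (hc : 0 ≤ c)
    (hw : ‖w‖ ≤ c * S.ρ * ‖x‖) : c • x + w ∈ S.cone := by
  rcases hc.eq_or_lt with rfl | hc
  · have : w = 0 := by simpa using hw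
    simp [this]
  · refine S.add_mem_of_mem_innerCone (S.smul_mem_innerCone hx hc) ?_
    rw [norm_smul, Real.norm_of_nonneg hc.le]
    linarith

theorem IsContraction.map_mem_innerCone {S : ConeSystem E} {L : E →L[ℝ] E}
    (hL : S.IsContraction L) {x : E} (hx : x ∈ S.cone) : L x ∈ S.innerCone := by
  by_cases h0 : x = 0
  · rw [h0, map_zero]; exact S.zero_mem_innerCone
  · exact (hL.maps x hx h0).1

/-- `L p` lies in the inner cone, so a perturbation of norm at most `ρ ‖L p‖` stays in the cone.
Outer regularity bounds `‖L x‖` by `K ℓ(L x)`, which the hypothesis compares with `ℓ(L p) ≤ ‖L p‖`.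
-/
theorem IsContraction.sub_smul_mem {S : ConeSystem E} {L : E →L[ℝ] E} (hL : S.IsContraction L)
    {x p : E} (hx : x ∈ S.cone) (hp : p ∈ S.cone) {d : ℝ} (hd : 0 ≤ d)
    (h : d * S.ℓ (L x) ≤ 2 * S.ℓ (L p)) : L p - (S.ρ / (2 * S.K) * d) • L x ∈ S.cone := by
  have hK := S.K_pos
  have hρ := S.ρ_pos
  rw [sub_eq_add_neg]
  refine S.add_mem_of_mem_innerCone (hL.map_mem_innerCone hp) ?_
  rw [norm_neg, norm_smul, Real.norm_of_nonneg (by positivity)]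
  have h1 : ‖L x‖ ≤ S.K * S.ℓ (L x) := S.norm_le_K_mul (hL.map_mem_innerCone hx).1
  have h2 : S.ℓ (L p) ≤ ‖L p‖ := (le_abs_self _).trans (S.ℓ_le_norm _)
  calc S.ρ / (2 * S.K) * d * ‖L x‖ ≤ S.ρ / (2 * S.K) * d * (S.K * S.ℓ (L x)) := by gcongr
    _ = S.ρ / 2 * (d * S.ℓ (L x)) := by field_simp
    _ ≤ S.ρ / 2 * (2 * ‖L p‖) :=
        mul_le_mul_of_nonneg_left (by linarith) (by positivity)
    _ = S.ρ * ‖L p‖ := by ring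

/-- One application of a contraction shrinks order intervals `[a x, b x]` by the factor
`S.rate`. -/
theorem IsContraction.shrink {S : ConeSystem E} {L : E →L[ℝ] E} (hL : S.IsContraction L)
    {x z : E} (hx : x ∈ S.cone) {a b : ℝ} (hab : a ≤ b) (ha : z - a • x ∈ S.cone)
    (hb : b • x - z ∈ S.cone) :
    ∃ a' b', a' ≤ b' ∧ b' - a' = S.rate * (b - a) ∧ L z - a' • L x ∈ S.cone ∧
      b' • L x - L z ∈ S.cone := by
  have hd : 0 ≤ b - a := sub_nonneg.2 hab
  have hr := mul_nonneg S.rate_pos.le hd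
  have hsum : S.ℓ (L (z - a • x)) + S.ℓ (L (b • x - z)) = (b - a) * S.ℓ (L x) := by
    simp only [map_sub, map_smul, smul_eq_mul]; ring
  -- The images of `z - a x` and `b x - z` add up to `(b - a) L x`, so one of them carries at least
  -- half of its `ℓ`-mass. The endpoint on that side is the one that moves.
  have hcase : (b - a) * S.ℓ (L x) ≤ 2 * S.ℓ (L (z - a • x)) ∨
      (b - a) * S.ℓ (L x) ≤ 2 * S.ℓ (L (b • x - z)) := by
    by_contra! h
    linarith [h.1, h.2]
  have ha' := (hL.map_mem_innerCone ha).1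
  have hb' := (hL.map_mem_innerCone hb).1
  rcases hcase with h | h
  · have h1 := hL.sub_smul_mem hx ha hd h
    refine ⟨a + S.ρ / (2 * S.K) * (b - a), b, ?_, ?_, ?_, by simpa using hb'⟩
    · unfold rate at hr; linarith
    · unfold rate; ring
    · convert h1 using 1
      simp only [map_sub, map_smul, add_smul]; abel
  · have h1 := hL.sub_smul_mem hx hb hd h
    refine ⟨a, b - S.ρ / (2 * S.K) * (b - a), ?_, ?_, by simpa using ha', ?_⟩
    · unfold rate at hr; linarith
    · unfold rate; ring
    · convert h1 using 1
      simp only [map_sub, map_smul, sub_smul]; abel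

/-- An element of a short order interval `[a x, b x]` is nearly proportional to `x`. -/
theorem norm_sub_smul_le (S : ConeSystem E) {x z : E} (hx : x ∈ S.cone) (hx0 : 0 < S.ℓ x)
    {a b : ℝ} (ha : z - a • x ∈ S.cone) (hb : b • x - z ∈ S.cone) :
    ‖z - (S.ℓ z / S.ℓ x) • x‖ ≤ 2 * S.K * (b - a) * S.ℓ x := by
  have hK := S.K_pos
  set w := z - a • x with hw
  have hw0 := S.ℓ_nonneg ha
  have hwb : S.ℓ w ≤ (b - a) * S.ℓ x := by
    have := S.ℓ_nonneg hb
    simp only [hw, map_sub, map_smul, smul_eq_mul] at this ⊢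
    linarith
  -- The projection along `x` onto `ker ℓ` kills multiples of `x`, so `z` may be replaced by the
  -- cone element `w`, whose norm is controlled by `ℓ w`.
  have heq : z - (S.ℓ z / S.ℓ x) • x = w - (S.ℓ w / S.ℓ x) • x := by
    have : S.ℓ w / S.ℓ x = S.ℓ z / S.ℓ x - a := by
      simp only [hw, map_sub, map_smul, smul_eq_mul]; field_simp
    rw [this, hw, sub_smul]; abel
  rw [heq]
  calc ‖w - (S.ℓ w / S.ℓ x) • x‖ ≤ ‖w‖ + (S.ℓ w / S.ℓ x) * ‖x‖ := by
        refine (norm_sub_le _ _).trans_eq ?_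
        rw [norm_smul, Real.norm_of_nonneg (by positivity)]
    _ ≤ S.K * S.ℓ w + (S.ℓ w / S.ℓ x) * (S.K * S.ℓ x) := by
        gcongr
        · exact S.norm_le_K_mul ha
        · exact S.norm_le_K_mul hx
    _ = 2 * S.K * S.ℓ w := by field_simp; ring
    _ ≤ 2 * S.K * ((b - a) * S.ℓ x) := by gcongr
    _ = 2 * S.K * (b - a) * S.ℓ x := by ring

end ConeSystem

/-! ### Iterates of the cocycle on sections. -/

namespace GradedCocycle

variable {r₀ : ℝ} {E : Set.Ioc (0 : ℝ) r₀ → Type*}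
  [∀ r, NormedAddCommGroup (E r)] [∀ r, NormedSpace ℝ (E r)] {G : GradedConeFamily r₀ E}
  {Ω : Type*} [MeasurableSpace Ω] {B : Type*} {U : Set B}

@[simp] theorem opX_val (A : GradedCocycle G Ω U) (τ : Ω ≃ᵐ Ω) (r : Set.Ioc (0 : ℝ) r₀) (u : U)
    (φ : SectionSpace Ω (E r)) (ω : Ω) :
    (A.opX τ r u φ).val ω = A.op r u (τ.symm ω) (φ.val (τ.symm ω)) := rfl

theorem opX_pow_succ_val (A : GradedCocycle G Ω U) (τ : Ω ≃ᵐ Ω) (r : Set.Ioc (0 : ℝ) r₀) (u : U)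
    (φ : SectionSpace Ω (E r)) (n : ℕ) (ω : Ω) :
    ((A.opX τ r u ^ (n + 1)) φ).val ω =
      A.op r u (τ.symm ω) (((A.opX τ r u ^ n) φ).val (τ.symm ω)) := by
  rw [pow_succ']; rfl

theorem pi_val (A : GradedCocycle G Ω U) (τ : Ω ≃ᵐ Ω) (r : Set.Ioc (0 : ℝ) r₀) (u : U)
    (φ : NormalizedSection Ω (G.sys r)) (ω : Ω) :
    (A.pi τ r u φ).1.val ω = ((A.Lam τ r u φ.1).val ω)⁻¹ • (A.opX τ r u φ.1).val ω := rfl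

theorem opX_pow_mem_cone (A : GradedCocycle G Ω U) (τ : Ω ≃ᵐ Ω) (r : Set.Ioc (0 : ℝ) r₀)
    (u : U) {φ : SectionSpace Ω (E r)} (hφ : ∀ ω, φ.val ω ∈ (G.sys r).cone) (n : ℕ) (ω : Ω) :
    ((A.opX τ r u ^ n) φ).val ω ∈ (G.sys r).cone := by
  induction n generalizing ω with
  | zero => exact hφ ω
  | succ n ih =>
    rw [opX_pow_succ_val]
    exact ((A.contraction r u _).map_mem_innerCone (ih _)).1

end GradedCocycle

theorem NormalizedSection.mem_cone {Ω : Type*} [MeasurableSpace Ω] {E : Type*}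
    [NormedAddCommGroup E] [NormedSpace ℝ E] {S : ConeSystem E} (φ : NormalizedSection Ω S)
    (ω : Ω) : φ.1.val ω ∈ S.cone := (φ.2 ω).1.1

theorem NormalizedSection.ℓ_eq {Ω : Type*} [MeasurableSpace Ω] {E : Type*}
    [NormedAddCommGroup E] [NormedSpace ℝ E] {S : ConeSystem E} (φ : NormalizedSection Ω S)
    (ω : Ω) : S.ℓ (φ.1.val ω) = 1 := (φ.2 ω).2

theorem NormalizedSection.ne_zero {Ω : Type*} [MeasurableSpace Ω] {E : Type*}
    [NormedAddCommGroup E] [NormedSpace ℝ E] {S : ConeSystem E} (φ : NormalizedSection Ω S)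
    (ω : Ω) : φ.1.val ω ≠ 0 := fun h => by simpa [h] using φ.ℓ_eq ω

theorem NormalizedSection.norm_le {Ω : Type*} [MeasurableSpace Ω] {E : Type*}
    [NormedAddCommGroup E] [NormedSpace ℝ E] {S : ConeSystem E} (φ : NormalizedSection Ω S) :
    ‖φ.1‖ ≤ S.K :=
  SectionSpace.norm_le _ S.K_pos.le fun ω => S.norm_le_K (φ.mem_cone ω) (φ.ℓ_eq ω)

namespace GradedCocycle

variable {r₀ : ℝ} {E : Set.Ioc (0 : ℝ) r₀ → Type*}
  [∀ r, NormedAddCommGroup (E r)] [∀ r, NormedSpace ℝ (E r)] {G : GradedConeFamily r₀ E}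
  {Ω : Type*} [MeasurableSpace Ω] {B : Type*} {U : Set B}

theorem opX_pow_ne_zero (A : GradedCocycle G Ω U) (τ : Ω ≃ᵐ Ω) (r : Set.Ioc (0 : ℝ) r₀)
    (u : U) (φ : NormalizedSection Ω (G.sys r)) (n : ℕ) (ω : Ω) :
    ((A.opX τ r u ^ n) φ.1).val ω ≠ 0 := by
  induction n generalizing ω with
  | zero => exact φ.ne_zero ω
  | succ n ih =>
    rw [opX_pow_succ_val]
    exact ((A.contraction r u _).maps _ (A.opX_pow_mem_cone τ r u φ.mem_cone n _) (ih _)).2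

theorem ℓ_opX_pow_pos (A : GradedCocycle G Ω U) (τ : Ω ≃ᵐ Ω) (r : Set.Ioc (0 : ℝ) r₀)
    (u : U) (φ : NormalizedSection Ω (G.sys r)) (n : ℕ) (ω : Ω) :
    0 < (G.sys r).ℓ (((A.opX τ r u ^ n) φ.1).val ω) :=
  (G.sys r).ℓ_pos (A.opX_pow_mem_cone τ r u φ.mem_cone n ω) (A.opX_pow_ne_zero τ r u φ n ω)

theorem exists_interval (A : GradedCocycle G Ω U) (τ : Ω ≃ᵐ Ω) (r : Set.Ioc (0 : ℝ) r₀) (u : U)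
    (φ : NormalizedSection Ω (G.sys r)) (z : SectionSpace Ω (E r)) (n : ℕ) (ω : Ω) :
    ∃ a b : ℝ, a ≤ b ∧ b - a = (G.sys r).rate ^ n * (2 * (‖z‖ / (G.sys r).ρ)) ∧
      ((A.opX τ r u ^ n) z).val ω - a • ((A.opX τ r u ^ n) φ.1).val ω ∈ (G.sys r).cone ∧
      b • ((A.opX τ r u ^ n) φ.1).val ω - ((A.opX τ r u ^ n) z).val ω ∈ (G.sys r).cone := by
  have hρ := (G.sys r).ρ_pos
  induction n generalizing ω with
  | zero =>
    have hD : 0 ≤ ‖z‖ / (G.sys r).ρ := by positivity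
    have hz : ‖z.val ω‖ ≤ ‖z‖ / (G.sys r).ρ * (G.sys r).ρ * ‖φ.1.val ω‖ := by
      rw [div_mul_cancel₀ _ hρ.ne']
      exact (SectionSpace.norm_val_le z ω).trans
        (le_mul_of_one_le_right (norm_nonneg _) ((G.sys r).one_le_norm (φ.ℓ_eq ω)))
    -- Since `φ_ω` is in the inner cone and `‖φ_ω‖ ≥ 1`, the cone contains `c φ_ω ± z_ω` as soon as
    -- `‖z‖ ≤ c ρ`.
    refine ⟨-(‖z‖ / (G.sys r).ρ), ‖z‖ / (G.sys r).ρ, by linarith, by ring, ?_, ?_⟩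
    · have := (G.sys r).smul_add_mem (φ.2 ω).1 hD hz
      simpa [add_comm] using this
    · have := (G.sys r).smul_add_mem (w := -z.val ω) (φ.2 ω).1 hD (by rwa [norm_neg])
      simpa [sub_eq_add_neg] using this
  | succ n ih =>
    obtain ⟨a, b, hab, hd, ha, hb⟩ := ih (τ.symm ω)
    obtain ⟨a', b', hab', hd', ha', hb'⟩ := (A.contraction r u (τ.symm ω)).shrink
      (A.opX_pow_mem_cone τ r u φ.mem_cone n _) hab ha hb
    simp only [opX_pow_succ_val]
    exact ⟨a', b', hab', by rw [hd', hd]; ring, ha', hb'⟩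

/-- Exponential decay, modulo the direction of `Lⁿ φ`, of the iterates `Lⁿ z`. -/
theorem norm_opX_pow_sub_le (A : GradedCocycle G Ω U) (τ : Ω ≃ᵐ Ω) (r : Set.Ioc (0 : ℝ) r₀)
    (u : U) (φ : NormalizedSection Ω (G.sys r)) (z : SectionSpace Ω (E r)) (n : ℕ) (ω : Ω) :
    ‖((A.opX τ r u ^ n) z).val ω - ((G.sys r).ℓ (((A.opX τ r u ^ n) z).val ω) /
        (G.sys r).ℓ (((A.opX τ r u ^ n) φ.1).val ω)) • ((A.opX τ r u ^ n) φ.1).val ω‖ ≤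
      4 * (G.sys r).K / (G.sys r).ρ * (G.sys r).rate ^ n * ‖z‖ *
        (G.sys r).ℓ (((A.opX τ r u ^ n) φ.1).val ω) := by
  obtain ⟨a, b, -, hd, ha, hb⟩ := A.exists_interval τ r u φ z n ω
  refine ((G.sys r).norm_sub_smul_le (A.opX_pow_mem_cone τ r u φ.mem_cone n ω)
    (A.ℓ_opX_pow_pos τ r u φ n ω) ha hb).trans_eq ?_
  rw [hd]; ring

/-- A positive fibrewise scalar factor cancels at the next normalization, so it suffices to
normalize once, after `n` linear steps. -/
theorem pi_iterate_val (A : GradedCocycle G Ω U) (τ : Ω ≃ᵐ Ω) (r : Set.Ioc (0 : ℝ) r₀) (u : U)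
    (φ : NormalizedSection Ω (G.sys r)) (n : ℕ) (ω : Ω) :
    ((A.pi τ r u)^[n] φ).1.val ω = ((G.sys r).ℓ (((A.opX τ r u ^ n) φ.1).val ω))⁻¹ •
      ((A.opX τ r u ^ n) φ.1).val ω := by
  induction n generalizing ω with
  | zero => simp [φ.ℓ_eq ω]
  | succ n ih =>
    have h := A.ℓ_opX_pow_pos τ r u φ n (τ.symm ω)
    rw [Function.iterate_succ_apply', pi_val, Lam_val, opX_val, ih, opX_pow_succ_val]
    simp only [map_smul, smul_smul, smul_eq_mul]
    congr 1
    rw [mul_inv, inv_inv, mul_right_comm, mul_inv_cancel₀ h.ne', one_mul]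

/-- The comparison of the growth of two normalized sections. -/
theorem ℓ_opX_pow_le (A : GradedCocycle G Ω U) (τ : Ω ≃ᵐ Ω) (r : Set.Ioc (0 : ℝ) r₀) (u : U)
    (φ ψ : NormalizedSection Ω (G.sys r)) (n : ℕ) (ω : Ω) :
    (G.sys r).ρ / (G.sys r).K * (G.sys r).ℓ (((A.opX τ r u ^ n) ψ.1).val ω) ≤
      (G.sys r).ℓ (((A.opX τ r u ^ n) φ.1).val ω) := by
  have hρ := (G.sys r).ρ_pos
  have hK := (G.sys r).K_pos
  -- The factor `ρ / K` is chosen so that `(ρ / K) ‖ψ_ω‖ ≤ ρ ≤ ρ ‖φ_ω‖`. Positivity of `Lⁿ` then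
  -- carries the order relation forward.
  have h : ∀ ω, (φ.1 - ((G.sys r).ρ / (G.sys r).K) • ψ.1).val ω ∈ (G.sys r).cone := fun ω => by
    rw [SectionSpace.val_sub, SectionSpace.val_smul, sub_eq_add_neg]
    refine (G.sys r).add_mem_of_mem_innerCone (φ.2 ω).1 ?_
    rw [norm_neg, norm_smul, Real.norm_of_nonneg (by positivity)]
    calc (G.sys r).ρ / (G.sys r).K * ‖ψ.1.val ω‖ ≤ (G.sys r).ρ / (G.sys r).K * (G.sys r).K := by
          gcongr
          exact (G.sys r).norm_le_K (ψ.mem_cone ω) (ψ.ℓ_eq ω)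
      _ = (G.sys r).ρ * 1 := by field_simp
      _ ≤ (G.sys r).ρ * ‖φ.1.val ω‖ := by
          gcongr
          exact (G.sys r).one_le_norm (φ.ℓ_eq ω)
  have h1 := (G.sys r).ℓ_nonneg (A.opX_pow_mem_cone τ r u h n ω)
  rw [map_sub, map_smul, SectionSpace.val_sub, SectionSpace.val_smul, map_sub, map_smul,
    smul_eq_mul] at h1
  linarith

/-- The iterates of `π_{r,u}` are exponentially contracting on normalized sections. -/
theorem norm_pi_iterate_sub_le (A : GradedCocycle G Ω U) (τ : Ω ≃ᵐ Ω) (r : Set.Ioc (0 : ℝ) r₀)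
    (u : U) (φ ψ : NormalizedSection Ω (G.sys r)) (n : ℕ) :
    ‖((A.pi τ r u)^[n] φ).1 - ((A.pi τ r u)^[n] ψ).1‖ ≤
      4 * (G.sys r).K / (G.sys r).ρ * ((G.sys r).K / (G.sys r).ρ) * ‖φ.1 - ψ.1‖ *
        (G.sys r).rate ^ n := by
  have hρ := (G.sys r).ρ_pos
  have hK := (G.sys r).K_pos
  have hr := (G.sys r).rate_pos
  refine SectionSpace.norm_le _ (by positivity) fun ω => ?_
  have hx := A.ℓ_opX_pow_pos τ r u ψ n ω
  have hy := A.ℓ_opX_pow_pos τ r u φ n ω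
  have hxy := A.ℓ_opX_pow_le τ r u φ ψ n ω
  have hz := A.norm_opX_pow_sub_le τ r u ψ (φ.1 - ψ.1) n ω
  rw [SectionSpace.val_sub, pi_iterate_val, pi_iterate_val]
  rw [map_sub, SectionSpace.val_sub, map_sub] at hz
  set x := ((A.opX τ r u ^ n) ψ.1).val ω
  set y := ((A.opX τ r u ^ n) φ.1).val ω
  set ℓ := (G.sys r).ℓ
  -- The difference of the normalized iterates is the transversal part of `Lⁿ(φ - ψ)` along `Lⁿ ψ`,
  -- which decays relative to `ℓ x`. The remaining ratio `ℓ x / ℓ y` is bounded by `hq`.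
  have heq : (ℓ y)⁻¹ • y - (ℓ x)⁻¹ • x = (ℓ y)⁻¹ • (y - x - ((ℓ y - ℓ x) / ℓ x) • x) := by
    have : (ℓ x)⁻¹ = (ℓ y)⁻¹ * (1 + (ℓ y - ℓ x) / ℓ x) := by field_simp; ring
    rw [this]
    module
  rw [heq, norm_smul, norm_inv, Real.norm_of_nonneg hy.le]
  have hq : (ℓ y)⁻¹ * ℓ x ≤ (G.sys r).K / (G.sys r).ρ := by
    rw [inv_mul_le_iff₀ hy]
    rw [div_mul_eq_mul_div, div_le_iff₀ hK] at hxy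
    rw [mul_div_assoc', le_div_iff₀ hρ]
    linarith
  calc _ ≤ (ℓ y)⁻¹ * _ := mul_le_mul_of_nonneg_left hz (by positivity)
    _ = 4 * (G.sys r).K / (G.sys r).ρ * ‖φ.1 - ψ.1‖ * (G.sys r).rate ^ n * ((ℓ y)⁻¹ * ℓ x) := by
        ring
    _ ≤ 4 * (G.sys r).K / (G.sys r).ρ * ‖φ.1 - ψ.1‖ * (G.sys r).rate ^ n *
        ((G.sys r).K / (G.sys r).ρ) := by gcongr
    _ = _ := by ring

end GradedCocycle

/-! ### Completeness and the fixed section. -/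

namespace SectionSpace

variable {Ω : Type*} [MeasurableSpace Ω] {E : Type*} [NormedAddCommGroup E] [NormedSpace ℝ E]

theorem continuous_val (ω : Ω) : Continuous fun φ : SectionSpace Ω E => φ.val ω := by
  refine LipschitzWith.continuous (K := 1) (LipschitzWith.of_dist_le_mul fun φ ψ => ?_)
  rw [dist_eq_norm, dist_eq_norm, NNReal.coe_one, one_mul, ← val_sub]
  exact norm_val_le _ ω

instance [CompleteSpace E] : CompleteSpace (SectionSpace Ω E) := by
  have hc : IsClosed ((SectionSpace Ω E : Submodule ℝ (lp (fun _ : Ω => E) ⊤)) :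
      Set (lp (fun _ : Ω => E) ⊤)) := by
    refine isClosed_of_closure_subset fun φ hφ => ?_
    obtain ⟨x, hx, hlim⟩ := mem_closure_iff_seq_limit.1 hφ
    refine stronglyMeasurable_of_tendsto Filter.atTop (f := fun n ω => x n ω) hx ?_
    rw [tendsto_pi_nhds]
    intro ω
    have hev : Continuous fun ψ : lp (fun _ : Ω => E) ⊤ => ψ ω := by
      refine LipschitzWith.continuous (K := 1) (LipschitzWith.of_dist_le_mul fun ψ χ => ?_)
      rw [dist_eq_norm, dist_eq_norm, NNReal.coe_one, one_mul]
      exact lp.norm_apply_le_norm ENNReal.top_ne_zero (ψ - χ) ω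
    exact (hev.tendsto φ).comp hlim
  exact hc.completeSpace_coe

end SectionSpace

theorem NormalizedSection.nonempty (Ω : Type*) [MeasurableSpace Ω] {E : Type*}
    [NormedAddCommGroup E] [NormedSpace ℝ E] (S : ConeSystem E) :
    Nonempty (NormalizedSection Ω S) := by
  obtain ⟨x, hx, hx0, hball⟩ := S.inner
  have hl := S.ℓ_pos hx hx0
  refine ⟨⟨SectionSpace.mk (fun _ => (S.ℓ x)⁻¹ • x) stronglyMeasurable_const
    ⟨_, fun _ => le_rfl⟩, fun ω => ⟨S.smul_mem_innerCone ⟨hx, hball⟩ (inv_pos.2 hl), ?_⟩⟩⟩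
  rw [SectionSpace.val_mk, map_smul, smul_eq_mul, inv_mul_cancel₀ hl.ne']

namespace GradedCocycle

variable {r₀ : ℝ} {E : Set.Ioc (0 : ℝ) r₀ → Type*}
  [∀ r, NormedAddCommGroup (E r)] [∀ r, NormedSpace ℝ (E r)] {G : GradedConeFamily r₀ E}
  {Ω : Type*} [MeasurableSpace Ω] {B : Type*} {U : Set B}

theorem eq_pi_iff (A : GradedCocycle G Ω U) (τ : Ω ≃ᵐ Ω) (r : Set.Ioc (0 : ℝ) r₀) (u : U)
    (φ : NormalizedSection Ω (G.sys r)) :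
    φ = A.pi τ r u φ ↔
      ∀ ω, (A.opX τ r u φ.1).val ω = (A.Lam τ r u φ.1).val ω • φ.1.val ω := by
  obtain ⟨c, hc, h⟩ := A.Lam_pos τ r u φ
  have hne : ∀ ω, (A.Lam τ r u φ.1).val ω ≠ 0 := fun ω => (hc.trans_le (h ω)).ne'
  constructor
  · intro hφ ω
    conv_rhs => rw [hφ]
    rw [pi_val, ← hφ, smul_smul, mul_inv_cancel₀ (hne ω), one_smul]
  · intro hφ
    refine Subtype.ext (SectionSpace.ext fun ω => ?_)
    rw [pi_val, hφ, smul_smul, inv_mul_cancel₀ (hne ω), one_smul]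

/-- A normalized eigensection with values in the cone has values in the inner cone. -/
theorem mem_innerCone_of_eigen (A : GradedCocycle G Ω U) (τ : Ω ≃ᵐ Ω) (r : Set.Ioc (0 : ℝ) r₀)
    (u : U) {g : SectionSpace Ω (E r)} (hg : ∀ ω, g.val ω ∈ (G.sys r).cone)
    (hg1 : ∀ ω, (G.sys r).ℓ (g.val ω) = 1)
    (h : ∀ ω, (A.opX τ r u g).val ω = (A.Lam τ r u g).val ω • g.val ω) (ω : Ω) :
    g.val ω ∈ (G.sys r).innerCone := by
  have h0 : g.val (τ.symm ω) ≠ 0 := fun h0 => by simpa [h0] using hg1 (τ.symm ω)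
  obtain ⟨h1, h2⟩ := (A.contraction r u (τ.symm ω)).maps _ (hg _) h0
  have h3 : 0 < (A.Lam τ r u g).val ω := (G.sys r).ℓ_pos h1.1 h2
  -- The value at `ω` is a positive multiple of an image under a contraction, and such images lie in
  -- the inner cone.
  have h4 : g.val ω = ((A.Lam τ r u g).val ω)⁻¹ • (A.opX τ r u g).val ω := by
    rw [h, smul_smul, inv_mul_cancel₀ h3.ne', one_smul]
  rw [h4]
  exact (G.sys r).smul_mem_innerCone h1 (inv_pos.2 h3)

theorem pi_fixed_unique (A : GradedCocycle G Ω U) (τ : Ω ≃ᵐ Ω) (r : Set.Ioc (0 : ℝ) r₀) (u : U)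
    {φ ψ : NormalizedSection Ω (G.sys r)} (hφ : φ = A.pi τ r u φ) (hψ : ψ = A.pi τ r u ψ) :
    φ = ψ := by
  have h : ∀ n : ℕ, ‖φ.1 - ψ.1‖ ≤ 4 * (G.sys r).K / (G.sys r).ρ *
      ((G.sys r).K / (G.sys r).ρ) * ‖φ.1 - ψ.1‖ * (G.sys r).rate ^ n := fun n => by
    have := A.norm_pi_iterate_sub_le τ r u φ ψ n
    rwa [Function.iterate_fixed hφ.symm, Function.iterate_fixed hψ.symm] at this
  have hlim := (tendsto_pow_atTop_nhds_zero_of_lt_one (G.sys r).rate_pos.le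
    (G.sys r).rate_lt_one).const_mul (4 * (G.sys r).K / (G.sys r).ρ *
      ((G.sys r).K / (G.sys r).ρ) * ‖φ.1 - ψ.1‖)
  rw [mul_zero] at hlim
  have h0 := ge_of_tendsto' hlim h
  exact Subtype.ext (sub_eq_zero.1 (norm_le_zero_iff.1 h0))

theorem exists_pi_fixed [∀ r, CompleteSpace (E r)] (A : GradedCocycle G Ω U) (τ : Ω ≃ᵐ Ω)
    (r : Set.Ioc (0 : ℝ) r₀) (u : U) : ∃ φ, φ = A.pi τ r u φ := by
  obtain ⟨φ₀⟩ := NormalizedSection.nonempty Ω (G.sys r)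
  set x : ℕ → NormalizedSection Ω (G.sys r) := fun n => (A.pi τ r u)^[n] φ₀ with hx
  have hxs : ∀ n, x (n + 1) = A.pi τ r u (x n) := fun n =>
    Function.iterate_succ_apply' _ _ _
  have hcau : CauchySeq fun n => (x n).1 := by
    refine cauchySeq_of_le_geometric (G.sys r).rate (4 * (G.sys r).K / (G.sys r).ρ *
      ((G.sys r).K / (G.sys r).ρ) * ‖φ₀.1 - (A.pi τ r u φ₀).1‖) (G.sys r).rate_lt_one
      fun n => ?_
    rw [dist_eq_norm]
    exact A.norm_pi_iterate_sub_le τ r u φ₀ (A.pi τ r u φ₀) n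
  obtain ⟨g, hg⟩ := cauchySeq_tendsto_of_complete hcau
  have hgω : ∀ ω, Filter.Tendsto (fun n => (x n).1.val ω) Filter.atTop (nhds (g.val ω)) :=
    fun ω => ((SectionSpace.continuous_val ω).tendsto g).comp hg
  have hcone : ∀ ω, g.val ω ∈ (G.sys r).cone := fun ω =>
    (G.sys r).cone.isClosed.mem_of_tendsto (hgω ω)
      (Filter.Eventually.of_forall fun n => (x n).mem_cone ω)
  have hone : ∀ ω, (G.sys r).ℓ (g.val ω) = 1 := fun ω =>
    tendsto_nhds_unique (((G.sys r).ℓ.continuous.tendsto _).comp (hgω ω))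
      (tendsto_const_nhds.congr fun n => ((x n).ℓ_eq ω).symm)
  have heig : ∀ ω, (A.opX τ r u g).val ω = (A.Lam τ r u g).val ω • g.val ω := fun ω => by
    have hL : Filter.Tendsto (fun n => (A.opX τ r u (x n).1).val ω) Filter.atTop
        (nhds ((A.opX τ r u g).val ω)) :=
      ((A.op r u (τ.symm ω)).continuous.tendsto _).comp (hgω (τ.symm ω))
    have hl : Filter.Tendsto (fun n => (A.Lam τ r u (x n).1).val ω) Filter.atTop
        (nhds ((A.Lam τ r u g).val ω)) := ((G.sys r).ℓ.continuous.tendsto _).comp hL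
    -- Passage to the limit in `L xₙ = Λ(xₙ) xₙ₊₁`, fibre by fibre.
    refine tendsto_nhds_unique hL
      ((hl.smul ((hgω ω).comp (Filter.tendsto_add_atTop_nat 1))).congr fun n => ?_)
    obtain ⟨c, hc, h⟩ := A.Lam_pos τ r u (x n)
    rw [Function.comp_apply, hxs, pi_val, smul_smul,
      mul_inv_cancel₀ (hc.trans_le (h ω)).ne', one_smul]
  refine ⟨⟨g, fun ω => ⟨A.mem_innerCone_of_eigen τ r u hcone hone heig ω, hone ω⟩⟩, ?_⟩
  exact (A.eq_pi_iff τ r u _).2 heig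

/-- A posteriori estimate for the fixed point of `π_{r,u}`. -/
theorem exists_norm_fixed_sub_le (A : GradedCocycle G Ω U) (τ : Ω ≃ᵐ Ω)
    (r : Set.Ioc (0 : ℝ) r₀) (u : U) {f : NormalizedSection Ω (G.sys r)}
    (hf : f = A.pi τ r u f) :
    ∃ C : ℝ, 0 ≤ C ∧ ∀ φ : NormalizedSection Ω (G.sys r),
      ‖φ.1 - f.1‖ ≤ C * ‖φ.1 - (A.pi τ r u φ).1‖ := by
  have hρ := (G.sys r).ρ_pos
  have hK := (G.sys r).K_pos
  set M := 4 * (G.sys r).K / (G.sys r).ρ * ((G.sys r).K / (G.sys r).ρ) with hM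
  have hM0 : 0 ≤ M := by positivity
  refine ⟨M / (1 - (G.sys r).rate),
    div_nonneg hM0 (sub_nonneg.2 (G.sys r).rate_lt_one.le), fun φ => ?_⟩
  have hlim : Filter.Tendsto (fun n => ((A.pi τ r u)^[n] φ).1) Filter.atTop (nhds f.1) := by
    rw [tendsto_iff_norm_sub_tendsto_zero]
    refine squeeze_zero (fun _ => norm_nonneg _) (fun n => ?_)
      (by simpa using (tendsto_pow_atTop_nhds_zero_of_lt_one (G.sys r).rate_pos.le
        (G.sys r).rate_lt_one).const_mul (M * ‖φ.1 - f.1‖))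
    have := A.norm_pi_iterate_sub_le τ r u φ f n
    rwa [Function.iterate_fixed hf.symm] at this
  -- Comparing the orbits of `φ` and `π φ` bounds consecutive iterates by a geometric sequence
  -- proportional to `‖φ - π φ‖`; its sum gives the constant `M / (1 - rate)`.
  have h := dist_le_of_le_geometric_of_tendsto₀ (G.sys r).rate
    (M * ‖φ.1 - (A.pi τ r u φ).1‖) (G.sys r).rate_lt_one (fun n => by
      rw [dist_eq_norm]
      exact A.norm_pi_iterate_sub_le τ r u φ (A.pi τ r u φ) n) hlim
  rw [dist_eq_norm] at h
  refine h.trans_eq ?_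
  ring

theorem down_val (A : GradedCocycle G Ω U) (s r : Set.Ioc (0 : ℝ) r₀) (h : s < r)
    (φ : SectionSpace Ω (E r)) (ω : Ω) : (A.down s r h φ).val ω = G.j s r h (φ.val ω) := rfl

theorem down_opX (A : GradedCocycle G Ω U) (τ : Ω ≃ᵐ Ω) (s r : Set.Ioc (0 : ℝ) r₀) (h : s < r)
    (u : U) (φ : SectionSpace Ω (E r)) :
    A.down s r h (A.opX τ r u φ) = A.opX τ s u (A.down s r h φ) :=
  SectionSpace.ext fun ω => A.comm s r h u (τ.symm ω) (φ.val (τ.symm ω))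

theorem Lam_down (A : GradedCocycle G Ω U) (τ : Ω ≃ᵐ Ω) (s r : Set.Ioc (0 : ℝ) r₀) (h : s < r)
    (u : U) (φ : SectionSpace Ω (E r)) :
    A.Lam τ s u (A.down s r h φ) = A.Lam τ r u φ := by
  refine SectionSpace.ext fun ω => ?_
  rw [Lam_val, Lam_val, G.ℓ_comp s r h, A.comm, down_val]

/-- The downgrading of a fixed point of `π_{r,u}` is the fixed point of `π_{s,u}`. -/
theorem down_fixed (A : GradedCocycle G Ω U) (τ : Ω ≃ᵐ Ω) (s r : Set.Ioc (0 : ℝ) r₀)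
    (h : s < r) (u : U) {f : NormalizedSection Ω (G.sys r)} (hf : f = A.pi τ r u f)
    {g : NormalizedSection Ω (G.sys s)} (hg : g = A.pi τ s u g) : g.1 = A.down s r h f.1 := by
  have hcone : ∀ ω, (A.down s r h f.1).val ω ∈ (G.sys s).cone := fun ω =>
    G.j_cone s r h _ (f.mem_cone ω)
  have hone : ∀ ω, (G.sys s).ℓ ((A.down s r h f.1).val ω) = 1 := fun ω => by
    rw [down_val, ← G.ℓ_comp]; exact f.ℓ_eq ω
  have heig : ∀ ω, (A.opX τ s u (A.down s r h f.1)).val ω =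
      (A.Lam τ s u (A.down s r h f.1)).val ω • (A.down s r h f.1).val ω := fun ω => by
    rw [← down_opX, Lam_down, down_val, (A.eq_pi_iff τ r u f).1 hf, map_smul, down_val]
  -- The injection is only known to map cone to cone; membership in the inner cone at level `s`
  -- comes from the eigenvalue equation.
  have hfix := (A.eq_pi_iff τ s u ⟨A.down s r h f.1, fun ω =>
    ⟨A.mem_innerCone_of_eigen τ s u hcone hone heig ω, hone ω⟩⟩).2 heig
  rw [A.pi_fixed_unique τ s u hg hfix]

theorem existsUnique_isFixedFamily [∀ r, CompleteSpace (E r)] (A : GradedCocycle G Ω U)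
    (τ : Ω ≃ᵐ Ω) : ∃! f : ∀ r, U → NormalizedSection Ω (G.sys r), A.IsFixedFamily τ f := by
  choose f hf using A.exists_pi_fixed τ
  refine ⟨f, ⟨fun s r h u => A.down_fixed τ s r h u (hf r u) (hf s u), hf⟩, fun g hg => ?_⟩
  funext r u
  exact A.pi_fixed_unique τ r u (hg.fixed r u) (hf r u)

/-! ### Powers of `Q` and invertibility of `1 - Q`. -/

theorem Q_val (A : GradedCocycle G Ω U) (τ : Ω ≃ᵐ Ω) (s : Set.Ioc (0 : ℝ) r₀) (u : U)
    (φ : NormalizedSection Ω (G.sys s)) (z : SectionSpace Ω (E s)) (ω : Ω) :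
    (A.Q τ s u φ z).val ω = ((A.Lam τ s u φ.1).val ω)⁻¹ •
      ((A.opX τ s u z).val ω - (A.Lam τ s u z).val ω • (A.pi τ s u φ).1.val ω) := rfl

/-- `Q` annihilates fibrewise multiples of `f`, so the correction subtracted at one step disappears
at the next. The formula fails for the zeroth power, which does not remove the component along `f`.
-/
theorem Q_pow_val (A : GradedCocycle G Ω U) (τ : Ω ≃ᵐ Ω) (s : Set.Ioc (0 : ℝ) r₀) (u : U)
    {f : NormalizedSection Ω (G.sys s)} (hf : f = A.pi τ s u f) (z : SectionSpace Ω (E s))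
    (n : ℕ) (ω : Ω) :
    ((A.Q τ s u f ^ (n + 1)) z).val ω =
      ((G.sys s).ℓ (((A.opX τ s u ^ (n + 1)) f.1).val ω))⁻¹ •
        (((A.opX τ s u ^ (n + 1)) z).val ω -
          (G.sys s).ℓ (((A.opX τ s u ^ (n + 1)) z).val ω) • f.1.val ω) := by
  induction n generalizing ω with
  | zero => rw [zero_add, pow_one, pow_one, Q_val, ← hf]; rfl
  | succ n ih =>
    have hstep : ∀ m, ((A.Q τ s u f ^ (m + 1)) z).val ω = _ := fun m => by
      rw [pow_succ', mul_apply_eq_comp, Q_val, ← hf, Lam_val, Lam_val, opX_val]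
    have hfn : ((A.opX τ s u ^ (n + 1)) f.1).val (τ.symm ω) =
        (G.sys s).ℓ (((A.opX τ s u ^ (n + 1)) f.1).val (τ.symm ω)) • f.1.val (τ.symm ω) := by
      have h1 := A.pi_iterate_val τ s u f (n + 1) (τ.symm ω)
      rw [Function.iterate_fixed hf.symm] at h1
      conv_rhs => rw [h1]
      rw [smul_smul, mul_inv_cancel₀ (A.ℓ_opX_pow_pos τ s u f (n + 1) _).ne', one_smul]
    have hl := A.ℓ_opX_pow_pos τ s u f (n + 1) (τ.symm ω)
    have hL : (A.opX τ s u f.1).val ω = (A.Lam τ s u f.1).val ω • f.1.val ω :=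
      (A.eq_pi_iff τ s u f).1 hf ω
    have hΛ : 0 < (A.Lam τ s u f.1).val ω := by
      obtain ⟨c, hc, h⟩ := A.Lam_pos τ s u f
      exact hc.trans_le (h ω)
    rw [opX_val] at hL
    rw [Lam_val] at hL hΛ
    generalize hlam : (G.sys s).ℓ (A.op s u (τ.symm ω) (f.1.val (τ.symm ω))) = lam at hL hΛ
    rw [hstep, ih, opX_pow_succ_val A τ s u z (n + 1), opX_pow_succ_val A τ s u f.1 (n + 1), hfn]
    simp only [map_smul, map_sub, smul_eq_mul, hL, f.ℓ_eq, mul_one, mul_inv]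
    module

theorem norm_Q_pow_le (A : GradedCocycle G Ω U) (τ : Ω ≃ᵐ Ω) (s : Set.Ioc (0 : ℝ) r₀) (u : U)
    {f : NormalizedSection Ω (G.sys s)} (hf : f = A.pi τ s u f) (n : ℕ) :
    ‖A.Q τ s u f ^ (n + 1)‖ ≤
      4 * (G.sys s).K / (G.sys s).ρ * (G.sys s).rate ^ (n + 1) := by
  have hρ := (G.sys s).ρ_pos
  have hK := (G.sys s).K_pos
  have hr := (G.sys s).rate_pos
  refine ContinuousLinearMap.opNorm_le_bound _ (by positivity) fun z =>
    SectionSpace.norm_le _ (by positivity) fun ω => ?_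
  have hl := A.ℓ_opX_pow_pos τ s u f (n + 1) ω
  have h := A.norm_opX_pow_sub_le τ s u f z (n + 1) ω
  have h1 := A.pi_iterate_val τ s u f (n + 1) ω
  rw [Function.iterate_fixed hf.symm] at h1
  rw [Q_pow_val A τ s u hf, norm_smul, norm_inv, Real.norm_of_nonneg hl.le,
    inv_mul_le_iff₀ hl]
  rw [h1, smul_smul, ← div_eq_mul_inv]
  exact h.trans_eq (by ring)

/-- Some power of `Q` has norm below one, though `Q` itself need not. Then `1 - Qᵐ` is a unit, and
it is the product of `1 - Q` with a geometric sum commuting with it. -/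
theorem isUnit_one_sub_Q [∀ r, CompleteSpace (E r)] (A : GradedCocycle G Ω U) (τ : Ω ≃ᵐ Ω)
    (s : Set.Ioc (0 : ℝ) r₀) (u : U) {f : NormalizedSection Ω (G.sys s)}
    (hf : f = A.pi τ s u f) : IsUnit (1 - A.Q τ s u f) := by
  have hlim := (tendsto_pow_atTop_nhds_zero_of_lt_one (G.sys s).rate_pos.le
    (G.sys s).rate_lt_one).const_mul (4 * (G.sys s).K / (G.sys s).ρ)
  rw [mul_zero] at hlim
  obtain ⟨n, hn⟩ := ((hlim.comp (Filter.tendsto_add_atTop_nat 1)).eventually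
    (gt_mem_nhds zero_lt_one)).exists
  have h := isUnit_one_sub_of_norm_lt_one
    (R := SectionSpace Ω (E s) →L[ℝ] SectionSpace Ω (E s)) ((A.norm_Q_pow_le τ s u hf n).trans_lt hn)
  rw [← mul_neg_geom_sum] at h
  exact ((Commute.isUnit_mul_iff (Commute.sum_right _ _ _ fun i _ =>
    ((Commute.one_left _).sub_left (Commute.self_pow _ i)))).1 h).1

end GradedCocycle

/-! ### Abstract differentiation lemmas. -/

open Asymptotics Topology in
/-- Differentiability of a function given implicitly by `(1 - Q) (f v - f u) ≈ T (y v)`, where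
`R` is a left inverse of `1 - Q` and `y` is differentiable at `u` with derivative `D`. -/
theorem hasFDerivAt_of_implicit {B X Y : Type*} [NormedAddCommGroup B] [NormedSpace ℝ B]
    [NormedAddCommGroup X] [NormedSpace ℝ X] [NormedAddCommGroup Y] [NormedSpace ℝ Y]
    {f : B → X} {y : B → Y} {u : B} {Q R : X →L[ℝ] X} {T : Y →L[ℝ] X} {D : B →L[ℝ] Y}
    {C C' : ℝ} (hR : ∀ x, R (x - Q x) = x)
    (hy : (fun v => y v - D (v - u)) =o[𝓝 u] fun v => v - u)
    (hfy : ∀ᶠ v in 𝓝 u, ‖f v - f u‖ ≤ C * ‖y v‖)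
    (hid : ∀ᶠ v in 𝓝 u, ‖f v - f u - Q (f v - f u) - T (y v)‖ ≤
      C' * ((‖f v - f u‖ + ‖y v‖) * ‖f v - f u‖)) :
    HasFDerivAt f (R.comp (T.comp D)) u := by
  have hyO : y =O[𝓝 u] fun v => v - u := by
    have := hy.isBigO.add (D.isBigO_comp (fun v => v - u) (𝓝 u))
    simpa using this
  have hfO : (fun v => f v - f u) =O[𝓝 u] fun v => v - u :=
    (IsBigO.of_bound C hfy).trans hyO
  have hlim : Filter.Tendsto (fun v : B => v - u) (𝓝 u) (𝓝 0) := by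
    have h : Continuous fun v : B => v - u := by fun_prop
    simpa using h.tendsto u
  have hsmall : (fun v => ‖f v - f u‖ + ‖y v‖) =o[𝓝 u] fun _ => (1 : ℝ) := by
    rw [isLittleO_one_iff]
    simpa using (hfO.trans_tendsto hlim).norm.add (hyO.trans_tendsto hlim).norm
  -- The a priori Lipschitz bound `hfO` turns the quadratic error into `o(v - u)`.
  have he : (fun v => f v - f u - Q (f v - f u) - T (y v)) =o[𝓝 u] fun v => v - u := by
    have h1 : (fun v => (‖f v - f u‖ + ‖y v‖) * ‖f v - f u‖) =o[𝓝 u] fun v => v - u := by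
      have := hsmall.mul_isBigO hfO.norm_norm
      simp only [one_mul] at this
      exact this.of_norm_right
    exact (IsBigO.of_bound C' (by
      filter_upwards [hid] with v hv
      rwa [Real.norm_of_nonneg (by positivity)])).trans_isLittleO h1
  rw [hasFDerivAt_iff_isLittleO]
  have h2 := ((R.isBigO_comp _ _).trans_isLittleO he).add
    (((R.comp T).isBigO_comp _ _).trans_isLittleO hy)
  refine h2.congr_left fun v => ?_
  conv_rhs => rw [← hR (f v - f u)]
  simp only [map_sub, ContinuousLinearMap.comp_apply]
  abel

open Asymptotics Topology in
/-- A differentiable family of operators applied to a merely continuous family of vectors. -/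
theorem exists_hasFDerivAt_apply {B X Y : Type*} [NormedAddCommGroup B] [NormedSpace ℝ B]
    [NormedAddCommGroup X] [NormedSpace ℝ X] [NormedAddCommGroup Y] [NormedSpace ℝ Y]
    {Φ : B → X →L[ℝ] Y} {n : WithTop ℕ∞} (hn : n ≠ 0) {U : Set B} (hU : IsOpen U)
    (hΦ : ContDiffOn ℝ n Φ U) {u : B} (hu : u ∈ U) {F : B → X} (hF : ContinuousAt F u) :
    ∃ D : B →L[ℝ] Y, HasFDerivAt (fun v => Φ v (F u)) D u ∧
      (fun v => (Φ v - Φ u) (F v) - D (v - u)) =o[𝓝 u] fun v => v - u := by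
  have hd := ((hΦ.contDiffAt (hU.mem_nhds hu)).differentiableAt hn).hasFDerivAt
  set D := fderiv ℝ Φ u
  refine ⟨D.flip (F u), ?_, ?_⟩
  · exact (ContinuousLinearMap.apply ℝ Y (F u)).hasFDerivAt.comp u hd
  rw [hasFDerivAt_iff_isLittleO] at hd
  have h1 : (fun v => (Φ v - Φ u - D (v - u)) (F v)) =o[𝓝 u] fun v => v - u := by
    refine IsBigO.trans_isLittleO (IsBigO.of_bound (‖F u‖ + 1) ?_) hd
    filter_upwards [hF.norm.eventually (gt_mem_nhds (lt_add_one _))] with v hv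
    rw [mul_comm]
    exact ContinuousLinearMap.le_of_opNorm_le_of_le _ le_rfl hv.le
  -- Replacing `F v` by `F u` costs only `o(v - u)`, because `D (v - u)` is already of first order;
  -- continuity of `F` is enough.
  have h2 : (fun v => (D (v - u)) (F v - F u)) =o[𝓝 u] fun v => v - u := by
    have h3 : (fun v => ‖v - u‖ * ‖F v - F u‖) =o[𝓝 u] fun v => v - u := by
      have h4 : (fun v => ‖F v - F u‖) =o[𝓝 u] fun _ => (1 : ℝ) :=
        (isLittleO_one_iff ℝ).2 (tendsto_iff_norm_sub_tendsto_zero.1 hF)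
      have := (isBigO_refl (fun v : B => ‖v - u‖) (𝓝 u)).mul_isLittleO h4
      simp only [mul_one] at this
      exact this.of_norm_right
    refine IsBigO.trans_isLittleO (IsBigO.of_bound ‖D‖ (Filter.Eventually.of_forall fun v => ?_)) h3
    rw [Real.norm_of_nonneg (by positivity), ← mul_assoc]
    exact (D (v - u)).le_of_opNorm_le (D.le_opNorm _) _
  refine (h1.add h2).congr_left fun v => ?_
  simp only [sub_apply, map_sub, ContinuousLinearMap.flip_apply]
  abel

theorem tendsto_norm_sub_of_contDiffOn {B Y : Type*} [NormedAddCommGroup B] [NormedSpace ℝ B]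
    [NormedAddCommGroup Y] [NormedSpace ℝ Y] {Φ : B → Y} {n : WithTop ℕ∞} {U : Set B}
    (hU : IsOpen U) (hΦ : ContDiffOn ℝ n Φ U) {u : B} (hu : u ∈ U) :
    Filter.Tendsto (fun v => ‖Φ v - Φ u‖) (nhds u) (nhds 0) :=
  tendsto_iff_norm_sub_tendsto_zero.1 (hΦ.continuousOn.continuousAt (hU.mem_nhds hu))

theorem fderiv_eq_comp_of_eventuallyEq {B X Y : Type*} [NormedAddCommGroup B] [NormedSpace ℝ B]
    [NormedAddCommGroup X] [NormedSpace ℝ X] [NormedAddCommGroup Y] [NormedSpace ℝ Y]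
    {T : X →L[ℝ] Y} {g : B → X} {w : B → Y} {D : B →L[ℝ] X} {u : B} (hg : HasFDerivAt g D u)
    (hw : ∀ᶠ v in nhds u, w v = T (g v)) : fderiv ℝ w u = T.comp D :=
  ((T.hasFDerivAt.comp u hg).congr_of_eventuallyEq hw).fderiv

theorem zeroExtend_coe {B Y : Type*} [Zero Y] {U : Set B} (f : U → Y) (v : U) :
    zeroExtend U f v = f v := by
  simp [zeroExtend]

/-! ### Linearization of the normalized eigenvalue equation. -/

namespace SectionSpace

variable {Ω : Type*} [MeasurableSpace Ω] {E : Type*} [NormedAddCommGroup E] [NormedSpace ℝ E]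

/-- The operator `y ↦ g⁻¹ (y - ⟨ℓ, y⟩ p)`. -/
noncomputable def tangent (ℓ : E →L[ℝ] ℝ) (g : SectionSpace Ω ℝ)
    (hg : ∃ c > 0, ∀ ω, c ≤ g.val ω) (p : SectionSpace Ω E) :
    SectionSpace Ω E →L[ℝ] SectionSpace Ω E :=
  (invMul g hg).comp (ContinuousLinearMap.id ℝ _ -
    (smulSection p).comp (fiberMap (fun _ => ℓ) (boundedField_const ℓ)))

theorem tangent_val (ℓ : E →L[ℝ] ℝ) (g : SectionSpace Ω ℝ)
    (hg : ∃ c > 0, ∀ ω, c ≤ g.val ω) (p y : SectionSpace Ω E) (ω : Ω) :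
    (tangent ℓ g hg p y).val ω = (g.val ω)⁻¹ • (y.val ω - ℓ (y.val ω) • p.val ω) := rfl

end SectionSpace

namespace ConeSystem

variable {E : Type*} [NormedAddCommGroup E] [NormedSpace ℝ E]

theorem norm_inv_smul_sub_le (S : ConeSystem E) {c l M N : ℝ} (hc : 0 < c) (hl : c ≤ l)
    {y p : E} (hy : ‖y‖ ≤ N) (hp : ‖p‖ ≤ M) : ‖l⁻¹ • (y - S.ℓ y • p)‖ ≤ c⁻¹ * (1 + M) * N := by
  have hl0 := hc.trans_le hl
  have hN : 0 ≤ N := (norm_nonneg _).trans hy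
  have h1 : ‖S.ℓ y • p‖ ≤ N * M := by
    rw [norm_smul]
    exact mul_le_mul ((S.ℓ_le_norm y).trans hy) hp (norm_nonneg _) hN
  rw [norm_smul, norm_inv, Real.norm_of_nonneg hl0.le, mul_assoc]
  refine mul_le_mul (inv_anti₀ hc hl) ((norm_sub_le _ _).trans ?_) (norm_nonneg _)
    (inv_nonneg.2 hc.le)
  linarith

/-- Remainder of the linearization of the projectivized eigenvalue equation. -/
theorem norm_linearization_le (S : ConeSystem E) {c l M : ℝ} (hc : 0 < c) (hl : c ≤ l)
    {p q a y : E} (h : l • p + a + y = (l + S.ℓ a + S.ℓ y) • q) (hM : ‖a‖ + ‖y‖ ≤ M) :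
    ‖q - p - l⁻¹ • (a - S.ℓ a • p) - l⁻¹ • (y - S.ℓ y • p)‖ ≤ c⁻¹ * (M * ‖q - p‖) := by
  have hl0 := hc.trans_le hl
  have hay : a + y = (l + S.ℓ a + S.ℓ y) • q - l • p := by rw [← h]; abel
  -- The remainder is exact: a scalar of first order times `q - p`.
  have heq : q - p - l⁻¹ • (a - S.ℓ a • p) - l⁻¹ • (y - S.ℓ y • p) =
      -(l⁻¹ • ((S.ℓ a + S.ℓ y) • (q - p))) := by
    have h1 : l⁻¹ • (a - S.ℓ a • p) + l⁻¹ • (y - S.ℓ y • p) =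
        l⁻¹ • ((a + y) - (S.ℓ a + S.ℓ y) • p) := by module
    have h2 : q - p = l⁻¹ • (l • (q - p)) := by
      rw [smul_smul, inv_mul_cancel₀ hl0.ne', one_smul]
    rw [sub_sub, h1, hay]
    nth_rewrite 1 [h2]
    module
  rw [heq, norm_neg, norm_smul, norm_smul, norm_inv, Real.norm_of_nonneg hl0.le]
  have h3 : ‖S.ℓ a + S.ℓ y‖ ≤ M :=
    (norm_add_le _ _).trans ((add_le_add (S.ℓ_le_norm a) (S.ℓ_le_norm y)).trans hM)
  have := inv_anti₀ hc hl
  gcongr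

end ConeSystem

/-! ### Dependence of the fixed section on the parameter. -/

namespace GradedCocycle

variable {r₀ : ℝ} {E : Set.Ioc (0 : ℝ) r₀ → Type*}
  [∀ r, NormedAddCommGroup (E r)] [∀ r, NormedSpace ℝ (E r)] {G : GradedConeFamily r₀ E}
  {Ω : Type*} [MeasurableSpace Ω] {B : Type*} {U : Set B}

theorem le_Lam (A : GradedCocycle G Ω U) (τ : Ω ≃ᵐ Ω) (r : Set.Ioc (0 : ℝ) r₀) (u : U)
    (φ : NormalizedSection Ω (G.sys r)) (ω : Ω) :
    (G.sys r).ρ / ((G.sys r).ϑ * (G.sys r).K) ≤ (A.Lam τ r u φ.1).val ω :=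
  (A.contraction r u (τ.symm ω)).le_ℓ (φ.2 (τ.symm ω)).1 (φ.2 (τ.symm ω)).2

theorem lower_const_pos (G : GradedConeFamily r₀ E) (r : Set.Ioc (0 : ℝ) r₀) :
    0 < (G.sys r).ρ / ((G.sys r).ϑ * (G.sys r).K) :=
  div_pos (G.sys r).ρ_pos (mul_pos (G.sys r).ϑ_pos (G.sys r).K_pos)

/-- The variation of the fixed point is controlled by the variation of the operator. -/
theorem exists_norm_sub_fixed_le (A : GradedCocycle G Ω U) (τ : Ω ≃ᵐ Ω)
    (r : Set.Ioc (0 : ℝ) r₀) (u : U) {f : U → NormalizedSection Ω (G.sys r)}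
    (hf : ∀ v, f v = A.pi τ r v (f v)) :
    ∃ C : ℝ, ∀ v, ‖(f v).1 - (f u).1‖ ≤
      C * ‖A.opX τ r v (f v).1 - A.opX τ r u (f v).1‖ := by
  obtain ⟨C, hC, h⟩ := A.exists_norm_fixed_sub_le τ r u (hf u)
  have hc := lower_const_pos G r
  have hK := (G.sys r).K_pos
  set c := (G.sys r).ρ / ((G.sys r).ϑ * (G.sys r).K)
  refine ⟨C * (c⁻¹ * (1 + (G.sys r).K)), fun v => (h (f v)).trans ?_⟩
  rw [mul_assoc]
  refine mul_le_mul_of_nonneg_left (SectionSpace.norm_le _ (by positivity) fun ω => ?_) hC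
  have hl := A.le_Lam τ r u (f v) ω
  have hl0 := hc.trans_le hl
  have heig := (A.eq_pi_iff τ r v (f v)).1 (hf v) ω
  have hΛ : ∀ w, (A.Lam τ r w (f v).1).val ω = (G.sys r).ℓ ((A.opX τ r w (f v).1).val ω) :=
    fun _ => rfl
  have hy := SectionSpace.norm_val_le (A.opX τ r v (f v).1 - A.opX τ r u (f v).1) ω
  have hfv : ‖(f v).1.val ω‖ ≤ (G.sys r).K :=
    (SectionSpace.norm_val_le _ ω).trans (f v).norm_le
  refine le_trans (le_of_eq ?_) ((G.sys r).norm_inv_smul_sub_le hc hl hy hfv)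
  congr 1
  -- By `heig`, the defect `f(v) - π_u(f(v))` equals the tangential part of `(L_v - L_u) f(v)`
  -- divided by `m`.
  rw [SectionSpace.val_sub, SectionSpace.val_sub, pi_val, map_sub, ← hΛ, ← hΛ, heig]
  set m := (A.Lam τ r u (f v).1).val ω
  have h2 : (f v).1.val ω = m⁻¹ • (m • (f v).1.val ω) := by
    rw [smul_smul, inv_mul_cancel₀ hl0.ne', one_smul]
  nth_rewrite 1 [h2]
  module

variable [NormedAddCommGroup B] [NormedSpace ℝ B]

/-- The operator variation at `f_s(v)` is that of `L_{s,v} j_{s,r}` applied to `f_r(v)`, whose norm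
is at most `K_r`. Thus only a bound is needed at the higher level. -/
theorem continuousAt_fixed (A : GradedCocycle G Ω U) (τ : Ω ≃ᵐ Ω) (hU : IsOpen U)
    {f : ∀ r, U → NormalizedSection Ω (G.sys r)} (hf : A.IsFixedFamily τ f)
    (s r : Set.Ioc (0 : ℝ) r₀) (h : s < r)
    {n : WithTop ℕ∞}
    (hreg : ContDiffOn ℝ n (zeroExtend U fun u => (A.opX τ s u).comp (A.down s r h)) U) (u : U) :
    ContinuousAt (zeroExtend U fun v => (f s v).1) u := by
  obtain ⟨C, hC⟩ := A.exists_norm_sub_fixed_le τ s u (hf.fixed s)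
  have hcont := tendsto_norm_sub_of_contDiffOn hU hreg u.2
  set Φ := zeroExtend U fun u => (A.opX τ s u).comp (A.down s r h) with hΦ
  have hlim : Filter.Tendsto (fun v => |C| * (‖Φ v - Φ u‖ * (G.sys r).K)) (nhds (u : B))
      (nhds 0) := by
    simpa using (hcont.mul_const (G.sys r).K).const_mul |C|
  refine tendsto_iff_norm_sub_tendsto_zero.2 ?_
  refine squeeze_zero' (Filter.Eventually.of_forall fun _ => norm_nonneg _) ?_ hlim
  filter_upwards [hU.mem_nhds u.2] with v hv
  lift v to U using hv
  rw [hΦ, zeroExtend_coe, zeroExtend_coe, zeroExtend_coe, zeroExtend_coe]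
  refine (hC v).trans (mul_le_mul (le_abs_self C) ?_ (norm_nonneg _) (abs_nonneg C))
  rw [hf.consistent s r h v]
  exact ContinuousLinearMap.le_of_opNorm_le_of_le
    ((A.opX τ s v).comp (A.down s r h) - (A.opX τ s u).comp (A.down s r h)) le_rfl
    (f r v).norm_le

open Asymptotics Topology in
/-- The variation of the operator at the moving fixed point is differentiable, although `f r` is
only continuous. -/
theorem exists_hasFDerivAt_opX (A : GradedCocycle G Ω U) (τ : Ω ≃ᵐ Ω) (hU : IsOpen U)
    {f : ∀ r, U → NormalizedSection Ω (G.sys r)} (hf : A.IsFixedFamily τ f)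
    (s r : Set.Ioc (0 : ℝ) r₀) (h : s < r) (u : U) {n : WithTop ℕ∞} (hn : n ≠ 0)
    (hreg : ContDiffOn ℝ n (zeroExtend U fun u => (A.opX τ s u).comp (A.down s r h)) U)
    (hcont : ContinuousAt (zeroExtend U fun v => (f r v).1) u) :
    ∃ D : B →L[ℝ] SectionSpace Ω (E s),
      HasFDerivAt (zeroExtend U fun v => A.opX τ s v (f s u).1) D u ∧
      (fun v => zeroExtend U (fun v => A.opX τ s v (f s v).1 - A.opX τ s u (f s v).1) v -
        D (v - u)) =o[𝓝 (u : B)] fun v => v - u := by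
  obtain ⟨D, hD, hD'⟩ := exists_hasFDerivAt_apply hn hU hreg u.2 hcont
  refine ⟨D, hD.congr_of_eventuallyEq ?_, hD'.congr' ?_ Filter.EventuallyEq.rfl⟩
  all_goals
    filter_upwards [hU.mem_nhds u.2] with v hv
    lift v to U using hv
    simp only [zeroExtend_coe, hf.consistent s r h, ContinuousLinearMap.comp_apply,
      sub_apply]

/-- `Λ` is unchanged by downgrading, so at the level `r` it can be differentiated through the weaker
space `X_s`, where the operator field is differentiable. -/
theorem dLam_eq (A : GradedCocycle G Ω U) (τ : Ω ≃ᵐ Ω) (hU : IsOpen U)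
    {f : ∀ r, U → NormalizedSection Ω (G.sys r)} (hf : A.IsFixedFamily τ f)
    (s r : Set.Ioc (0 : ℝ) r₀) (h : s < r) (u : U) {D : B →L[ℝ] SectionSpace Ω (E s)}
    (hD : HasFDerivAt (zeroExtend U fun v => A.opX τ s v (f s u).1) D u) :
    A.dLam τ r u (f r u).1 = (SectionSpace.fiberMap (fun _ => (G.sys s).ℓ)
      (SectionSpace.boundedField_const _)).comp D := by
  refine fderiv_eq_comp_of_eventuallyEq hD ?_
  filter_upwards [hU.mem_nhds u.2] with v hv
  lift v to U using hv
  rw [zeroExtend_coe, zeroExtend_coe, ← Lam_down A τ s r h, ← hf.consistent]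
  rfl

theorem P_eq (A : GradedCocycle G Ω U) (τ : Ω ≃ᵐ Ω) (hU : IsOpen U)
    {f : ∀ r, U → NormalizedSection Ω (G.sys r)} (hf : A.IsFixedFamily τ f)
    (s r : Set.Ioc (0 : ℝ) r₀) (h : s < r) (u : U) {D : B →L[ℝ] SectionSpace Ω (E s)}
    (hD : HasFDerivAt (zeroExtend U fun v => A.opX τ s v (f s u).1) D u) :
    A.P τ s r h u (f r u) = (SectionSpace.tangent (G.sys s).ℓ (A.Lam τ s u (f s u).1)
      (A.Lam_pos τ s u (f s u)) (f s u).1).comp D := by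
  have hD1 : A.dOp τ s r h u (f r u).1 = D := by
    have : (fun v => A.down s r h (A.opX τ r v (f r u).1)) =
        fun v => A.opX τ s v (f s u).1 := by
      funext v; rw [down_opX, hf.consistent s r h]
    rw [dOp, this]
    exact hD.fderiv
  have hD2 := A.dLam_eq τ hU hf s r h u hD
  refine ContinuousLinearMap.ext fun δ => SectionSpace.ext fun ω => ?_
  rw [P, hD1, hD2, ← hf.fixed, ← hf.consistent, ContinuousLinearMap.comp_apply,
    ContinuousLinearMap.comp_apply, SectionSpace.tangent_val, SectionSpace.invMul_val,
    ← Lam_down A τ s r h, ← hf.consistent]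
  rfl

/-- With the section frozen, the downgraded `π_v` is the normalization of `L_{s,v} f_s(u)`. The
implicit scheme applies with `Q = 0` and no term `a`. -/
theorem hasFDerivAt_pi (A : GradedCocycle G Ω U) (τ : Ω ≃ᵐ Ω) (hU : IsOpen U)
    {f : ∀ r, U → NormalizedSection Ω (G.sys r)} (hf : A.IsFixedFamily τ f)
    (s r : Set.Ioc (0 : ℝ) r₀) (h : s < r) (u : U) {D : B →L[ℝ] SectionSpace Ω (E s)}
    (hD : HasFDerivAt (zeroExtend U fun v => A.opX τ s v (f s u).1) D u) :
    HasFDerivAt (zeroExtend U fun v => A.down s r h (A.pi τ r v (f r u)).1)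
      (A.P τ s r h u (f r u)) u := by
  have hc := lower_const_pos G s
  have hK := (G.sys r).K_pos
  set c := (G.sys s).ρ / ((G.sys s).ϑ * (G.sys s).K)
  set M := ‖A.down s r h‖ * (G.sys r).K with hM
  have hM0 : 0 ≤ M := by positivity
  have hgu : A.down s r h (A.pi τ r u (f r u)).1 = (f s u).1 := by
    rw [← hf.fixed, hf.consistent s r h]
  have heig : ∀ (v : U) ω, (A.opX τ s v (f s u).1).val ω =
      (A.Lam τ s v (f s u).1).val ω • (A.down s r h (A.pi τ r v (f r u)).1).val ω := fun v ω => by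
    obtain ⟨c', hc', h'⟩ := A.Lam_pos τ r v (f r u)
    rw [hf.consistent s r h, Lam_down, ← down_opX, down_val, down_val, pi_val, map_smul,
      smul_smul, mul_inv_cancel₀ (hc'.trans_le (h' ω)).ne', one_smul]
  have hΛ : ∀ v ω, (A.Lam τ s v (f s u).1).val ω =
      (G.sys s).ℓ ((A.opX τ s v (f s u).1).val ω) := fun _ _ => rfl
  rw [A.P_eq τ hU hf s r h u hD]
  rw [← ContinuousLinearMap.id_comp ((SectionSpace.tangent _ _ _ _).comp D)]
  refine hasFDerivAt_of_implicit (R := ContinuousLinearMap.id ℝ (SectionSpace Ω (E s))) (Q := 0)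
    (y := fun v => zeroExtend U (fun v => A.opX τ s v (f s u).1) v - A.opX τ s u (f s u).1)
    (C := c⁻¹ * (1 + M)) (C' := c⁻¹) (fun x => by simp) ?_ ?_ ?_
  · have := hasFDerivAt_iff_isLittleO.1 hD
    rwa [zeroExtend_coe] at this
  · filter_upwards [hU.mem_nhds u.2] with v hv
    lift v to U using hv
    rw [zeroExtend_coe, zeroExtend_coe, zeroExtend_coe, hgu]
    refine SectionSpace.norm_le _ (by positivity) fun ω => ?_
    have hl := A.le_Lam τ s u (f s u) ω
    have hl0 := hc.trans_le hl
    have hg : ‖(A.down s r h (A.pi τ r v (f r u)).1).val ω‖ ≤ M :=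
      (SectionSpace.norm_val_le _ ω).trans
        ((A.down s r h).le_of_opNorm_le_of_le le_rfl (A.pi τ r v (f r u)).norm_le)
    refine le_trans (le_of_eq ?_) ((G.sys s).norm_inv_smul_sub_le hc hl
      (SectionSpace.norm_val_le (A.opX τ s v (f s u).1 - A.opX τ s u (f s u).1) ω) hg)
    congr 1
    have h1 := heig u ω
    rw [hgu] at h1
    rw [SectionSpace.val_sub, SectionSpace.val_sub, map_sub, ← hΛ, ← hΛ, heig v, h1]
    set m := (A.Lam τ s u (f s u).1).val ω
    set g := (A.down s r h (A.pi τ r v (f r u)).1).val ω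
    have h2 : g - (f s u).1.val ω = m⁻¹ • (m • (g - (f s u).1.val ω)) := by
      rw [smul_smul, inv_mul_cancel₀ hl0.ne', one_smul]
    rw [h2]
    module
  · filter_upwards [hU.mem_nhds u.2] with v hv
    lift v to U using hv
    rw [zeroExtend_coe, zeroExtend_coe, zeroExtend_coe, hgu]
    set y := A.opX τ s v (f s u).1 - A.opX τ s u (f s u).1 with hy
    refine SectionSpace.norm_le _ (by positivity) fun ω => ?_
    have hk := SectionSpace.norm_val_le (A.down s r h (A.pi τ r v (f r u)).1 - (f s u).1) ω
    rw [SectionSpace.val_sub] at hk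
    have hyω := SectionSpace.norm_val_le y ω
    have h1 := heig u ω
    rw [hgu] at h1
    have key := (G.sys s).norm_linearization_le hc (A.le_Lam τ s u (f s u) ω)
      (p := (f s u).1.val ω) (q := (A.down s r h (A.pi τ r v (f r u)).1).val ω) (a := 0)
      (y := y.val ω) (M := ‖y‖) ?_ (by simpa using hyω)
    · rw [map_zero, zero_smul, sub_zero, smul_zero, sub_zero] at key
      rw [SectionSpace.val_sub, SectionSpace.val_sub, SectionSpace.val_sub,
        SectionSpace.tangent_val, zero_apply]
      rw [show (0 : SectionSpace Ω (E s)).val ω = 0 from rfl, sub_zero]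
      refine key.trans ?_
      have : c⁻¹ * (‖y‖ * ‖(A.down s r h (A.pi τ r v (f r u)).1).val ω - (f s u).1.val ω‖) ≤
          c⁻¹ * (‖y‖ * ‖A.down s r h (A.pi τ r v (f r u)).1 - (f s u).1‖) := by gcongr
      refine this.trans ?_
      gcongr
      exact le_add_of_nonneg_left (norm_nonneg _)
    · rw [← h1, hy, SectionSpace.val_sub, map_zero, add_zero, add_zero, map_sub, ← hΛ, ← hΛ,
        add_sub_cancel, add_sub_cancel, heig v]

open Asymptotics Topology in
-- Here the section moves too: `L_v f(v) = L_u f(u) + L_u k + y`. Linearizing the term `L_u k`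
-- produces `Q k`, and `y` produces the `P` term.
theorem hasFDerivAt_fixed [∀ r, CompleteSpace (E r)] (A : GradedCocycle G Ω U) (τ : Ω ≃ᵐ Ω)
    (hU : IsOpen U) {f : ∀ r, U → NormalizedSection Ω (G.sys r)} (hf : A.IsFixedFamily τ f)
    (s r : Set.Ioc (0 : ℝ) r₀) (h : s < r) (u : U) {D : B →L[ℝ] SectionSpace Ω (E s)}
    (hD : HasFDerivAt (zeroExtend U fun v => A.opX τ s v (f s u).1) D u)
    (hD' : (fun v => zeroExtend U (fun v => A.opX τ s v (f s v).1 - A.opX τ s u (f s v).1) v -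
        D (v - u)) =o[𝓝 (u : B)] fun v => v - u) :
    HasFDerivAt (zeroExtend U fun v => (f s v).1)
      ((Ring.inverse (1 - A.Q τ s u (f s u))).comp (A.P τ s r h u (f r u))) u := by
  have hc := lower_const_pos G s
  set c := (G.sys s).ρ / ((G.sys s).ϑ * (G.sys s).K)
  obtain ⟨C, hC⟩ := A.exists_norm_sub_fixed_le τ s u (hf.fixed s)
  have hunit := A.isUnit_one_sub_Q τ s u (hf.fixed s u)
  rw [A.P_eq τ hU hf s r h u hD]
  refine hasFDerivAt_of_implicit (Q := A.Q τ s u (f s u)) (C := C)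
    (C' := c⁻¹ * (‖A.opX τ s u‖ + 1)) (fun x => ?_) hD' ?_ ?_
  · exact DFunLike.congr_fun (Ring.inverse_mul_cancel _ hunit) x
  · filter_upwards [hU.mem_nhds u.2] with v hv
    lift v to U using hv
    rw [zeroExtend_coe, zeroExtend_coe, zeroExtend_coe]
    exact hC v
  · filter_upwards [hU.mem_nhds u.2] with v hv
    lift v to U using hv
    rw [zeroExtend_coe, zeroExtend_coe, zeroExtend_coe]
    set y := A.opX τ s v (f s v).1 - A.opX τ s u (f s v).1 with hy
    set k := (f s v).1 - (f s u).1 with hk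
    refine SectionSpace.norm_le _ (by positivity) fun ω => ?_
    have hΛ : ∀ v w ω, (A.Lam τ s v (f s w).1).val ω =
      (G.sys s).ℓ ((A.opX τ s v (f s w).1).val ω) := fun _ _ _ => rfl
    have heig : ∀ v ω, (A.opX τ s v (f s v).1).val ω =
      (A.Lam τ s v (f s v).1).val ω • (f s v).1.val ω := fun v =>
      (A.eq_pi_iff τ s v (f s v)).1 (hf.fixed s v)
    have hsum : (A.opX τ s u (f s u).1).val ω + (A.opX τ s u k).val ω + y.val ω =
        (A.opX τ s v (f s v).1).val ω := by
      rw [hy, hk, map_sub, SectionSpace.val_sub, SectionSpace.val_sub]; abel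
    have key := (G.sys s).norm_linearization_le hc (A.le_Lam τ s u (f s u) ω)
      (p := (f s u).1.val ω) (q := (f s v).1.val ω) (a := (A.opX τ s u k).val ω)
      (y := y.val ω) (M := ‖A.opX τ s u‖ * ‖k‖ + ‖y‖) ?_
      (add_le_add ((SectionSpace.norm_val_le _ ω).trans ((A.opX τ s u).le_opNorm k))
        (SectionSpace.norm_val_le y ω))
    · rw [SectionSpace.val_sub, SectionSpace.val_sub, SectionSpace.tangent_val, Q_val,
        ← hf.fixed s u]
      have hkω := SectionSpace.norm_val_le k ω
      rw [hk, SectionSpace.val_sub, ← hk] at hkω ⊢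
      refine key.trans ?_
      calc _ ≤ c⁻¹ * ((‖A.opX τ s u‖ * ‖k‖ + ‖y‖) * ‖k‖) := by gcongr
        _ ≤ c⁻¹ * (((‖A.opX τ s u‖ + 1) * (‖k‖ + ‖y‖)) * ‖k‖) := by
          gcongr
          nlinarith [mul_nonneg (norm_nonneg (A.opX τ s u)) (norm_nonneg y), norm_nonneg k]
        _ = _ := by ring
    · rw [← heig u, hsum, hΛ, ← map_add, ← map_add, hsum, ← hΛ, ← heig v]

end GradedCocycle

/-! ### Choice of the intermediate level. -/

theorem mainTheorem7 {r₀ : ℝ} (hr₀ : 0 < r₀)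
    {E : Set.Ioc (0 : ℝ) r₀ → Type*} [∀ r, NormedAddCommGroup (E r)] [∀ r, NormedSpace ℝ (E r)]
    [∀ r, CompleteSpace (E r)] (G : GradedConeFamily r₀ E)
    {Ω : Type*} [MeasurableSpace Ω] (μ : MeasureTheory.Measure Ω)
    [MeasureTheory.IsProbabilityMeasure μ] (τ : Ω ≃ᵐ Ω) (hτ : Ergodic τ μ)
    {B : Type*} [NormedAddCommGroup B] [NormedSpace ℝ B] [CompleteSpace B]
    {U : Set B} (hUo : IsOpen U) (hUc : Convex ℝ U) (A : GradedCocycle G Ω U)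
    (hreg : ∀ (s r : Set.Ioc (0 : ℝ) r₀) (h : s < r) (t : ℝ), 0 ≤ t → t < (r : ℝ) - s →
      IsOfClass t (zeroExtend U fun u => (A.opX τ s u).comp (A.down s r h)) U) :
    (∃! f : ∀ r, U → NormalizedSection Ω (G.sys r), A.IsFixedFamily τ f) ∧
    ∀ f : ∀ r, U → NormalizedSection Ω (G.sys r), A.IsFixedFamily τ f →
      ∀ (s : Set.Ioc (0 : ℝ) r₀) (hs : (s : ℝ) < r₀ - 1) (u : U),
        let top : Set.Ioc (0 : ℝ) r₀ := ⟨r₀, hr₀, le_rfl⟩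
        have hst : s < top := Subtype.coe_lt_coe.1 (hs.trans (sub_one_lt r₀))
        HasFDerivAt (zeroExtend U fun v => A.down s top hst (A.pi τ top v (f top u)).1)
          (A.P τ s top hst u (f top u)) u ∧
        IsUnit (1 - A.Q τ s u (f s u)) ∧
        HasFDerivAt (zeroExtend U fun v => (f s v).1)
          ((Ring.inverse (1 - A.Q τ s u (f s u))).comp (A.P τ s top hst u (f top u))) u := by
  refine ⟨A.existsUnique_isFixedFamily τ, fun f hf s hs u => ?_⟩
  intro top hst
  have hs0 : (0 : ℝ) < s := s.2.1
  -- The gap from `s` to `r` exceeds one and yields differentiability; the positive gap from `r` to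
  -- `r₀` yields continuity of `f_r`.
  obtain ⟨r', hr1, hr2⟩ := exists_between (lt_sub_iff_add_lt.1 hs)
  set r : Set.Ioc (0 : ℝ) r₀ := ⟨r', by linarith, hr2.le⟩ with hr
  have hsr : s < r := Subtype.coe_lt_coe.1 (show (s : ℝ) < r' by linarith)
  have hrt : r < top := Subtype.coe_lt_coe.1 hr2
  obtain ⟨t, ht1, ht2⟩ := exists_between (lt_sub_iff_add_lt'.2 hr1)
  have hreg1 := (hreg s r hsr t (by linarith) ht2).1
  -- For `t = 0` the truncated `⌈t⌉₊ - 1` is `0`, which is plain continuity; for the chosen `t > 1`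
  -- it is at least `1`.
  have hreg0 := (hreg r top hrt 0 le_rfl (sub_pos.2 hr2)).1
  have hcont := A.continuousAt_fixed τ hUo hf r top hrt hreg0 u
  have hn : ((⌈t⌉₊ - 1 : ℕ) : WithTop ℕ∞) ≠ 0 := by
    have : 1 < ⌈t⌉₊ := Nat.lt_ceil.2 (by simpa using ht1)
    rw [Nat.cast_ne_zero]
    omega
  obtain ⟨D, hD, hD'⟩ := A.exists_hasFDerivAt_opX τ hUo hf s r hsr u hn hreg1 hcont
  exact ⟨A.hasFDerivAt_pi τ hUo hf s top hst u hD,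
    A.isUnit_one_sub_Q τ s u (hf.fixed s u),
    A.hasFDerivAt_fixed τ hUo hf s top hst u hD hD'⟩
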